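/- Let $(M,g)$ be a second countable Riemannian manifold without boundary, with Riemannian volume $\mu_g$, and let $S\to M$ be a complex Hermitian vector bundle of finite rank (for instance the spinor bundle, when $M$ is spin, or the trivial line bundle). Let $\mathcal H=L^2(M,S)$ be the Hilbert space of its square-integrable sections. Let $\alpha$ be a smooth isometric action of $\mathbb R^l$ on $M$, written $(z,p)\mapsto z\cdot p$, put $(\alpha_z f)(p)=f((-z)\cdot p)$, and let $z\mapsto V_z$ be a strongly continuous unitary representation of $\mathbb R^l$ on $\mathcal H$ that covers $\alpha$, that is, $V_z(f\psi)=(\alpha_z f)\,V_z\psi$ for $f\in C_c^\infty(M)$, $\psi\in\mathcal H$, $z\in\mathbb R^l$. Let $\Theta$ be a real skew-symmetric $l\times l$ matrix. For a bounded operator $A$ on $\mathcal H$, its left and right twists are the operators $$L_A=(2\pi)^{-l}\int_{\mathbb R^{2l}}e^{-iy\cdot z}\,V_{\frac12\Theta y}\,A\,V_{-\frac12\Theta y-z}\,d^ly\,d^lz,\qquad R_A=(2\pi)^{-l}\int_{\mathbb R^{2l}}e^{-iy\cdot z}\,V_{-z}\,A\,V_{z+\frac12\Theta y}\,d^ly\,d^lz,$$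 whenever these oscillatory integrals converge strongly, that is, if, applied to any $\psi\in\mathcal H$ and with a factor $\chi(\varepsilon y,\varepsilon z)$ inserted in the integrand, they converge in $\mathcal H$ as $\varepsilon\downarrow0$, for every Schwartz function $\chi$ on $\mathbb R^{2l}$ with $\chi(0)=1$, to a limit that does not depend on $\chi$ and is given by a bounded operator applied to $\psi$. **Theorem.** Let $A$ be a Hilbert–Schmidt operator on $\mathcal H$. Then the integrals that define $L_A$ and $R_A$ converge in this sense, $L_A$ and $R_A$ are Hilbert–Schmidt operators, and $$\|L_A\|_2=\|R_A\|_2=\|A\|_2 .$$ Moreover, the Hilbert–Schmidt operators on $\mathcal H$ are exactly the bounded operators $A$ with a square-integrable kernel $K_A$, a section over $M\times M$ with $K_A(p,p')\in\operatorname{Hom}(S_{p'},S_p)$ and $\int_{M\times M}\|K_A(p,p')\|_2^2\,d\mu_g(p)\,d\mu_g(p')<\infty$. Every such kernel $K$ is the kernel of an operator $A$, with $\|A\|_2=\|K\|_{L^2(M\times M)}$, and the map $K_A\mapsto K_{L_A}$ is an isometry of this space $L^2(M\times M)$ of kernels into itself. -/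

import Mathlib

open Bundle MeasureTheory Filter Topology
open scoped ENNReal Manifold ContDiff InnerProductSpace SchwartzMap

noncomputable section

namespace TwistedHS

/-! ### Hilbert–Schmidt operators -/

section HilbertSchmidt

variable {H H' : Type*} [NormedAddCommGroup H] [InnerProductSpace ℂ H]
  [NormedAddCommGroup H'] [InnerProductSpace ℂ H']

/-- The square `∑ i, ‖A e i‖ ^ 2` of the Hilbert–Schmidt norm of an operator between Hilbert
spaces, where `e` is an orthonormal basis. The sum does not depend on the basis
(`hsNormSq_eq_tsum`), so that the supremum over all of them is only a way not to choose one. -/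
def hsNormSq (A : H →L[ℂ] H') : ℝ≥0∞ :=
  ⨆ (w : Set H) (e : HilbertBasis w ℂ H), ∑' i, ‖A (e i)‖ₑ ^ 2

/-- The Hilbert–Schmidt norm of an operator, with the value `∞` if the operator is not
Hilbert–Schmidt. -/
def hsNorm (A : H →L[ℂ] H') : ℝ≥0∞ := hsNormSq A ^ (1 / 2 : ℝ)

/-- Hilbert–Schmidt operators. -/
def IsHilbertSchmidt (A : H →L[ℂ] H') : Prop := hsNorm A < ⊤

theorem tsum_enorm_inner_sq {ι : Type*} (e : HilbertBasis ι ℂ H) (x : H) :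
    ∑' i, ‖⟪e i, x⟫_ℂ‖ₑ ^ 2 = ‖x‖ₑ ^ 2 := by
  have h := (e.hasSum_inner_mul_inner x x).mapL Complex.reCLM
  have h2 : HasSum (fun i => ‖⟪e i, x⟫_ℂ‖ ^ 2) (‖x‖ ^ 2) := by
    convert h using 1
    · funext i
      simp only [Complex.reCLM_apply]
      rw [← inner_conj_symm x (e i), ← Complex.normSq_eq_conj_mul_self, Complex.ofReal_re,
        Complex.normSq_eq_norm_sq]
    · simp [inner_self_eq_norm_sq_to_K, ← Complex.ofReal_pow]
  have h3 : ∀ r : ℂ, ‖r‖ₑ ^ 2 = ENNReal.ofReal (‖r‖ ^ 2) := fun r => by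
    rw [ENNReal.ofReal_pow (norm_nonneg _), ofReal_norm]
  simp_rw [h3]
  rw [← ENNReal.ofReal_tsum_of_nonneg (fun i => by positivity) h2.summable, h2.tsum_eq,
    ENNReal.ofReal_pow (norm_nonneg _), ofReal_norm]

theorem tsum_enorm_sq_eq_adjoint [CompleteSpace H] [CompleteSpace H'] {ι κ : Type*}
    (e : HilbertBasis ι ℂ H) (f : HilbertBasis κ ℂ H') (A : H →L[ℂ] H') :
    ∑' i, ‖A (e i)‖ₑ ^ 2 = ∑' j, ‖ContinuousLinearMap.adjoint A (f j)‖ₑ ^ 2 := by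
  simp_rw [← tsum_enorm_inner_sq f (A _), ← tsum_enorm_inner_sq e (ContinuousLinearMap.adjoint A _)]
  rw [ENNReal.tsum_comm]
  congr! 5 with j i
  rw [ContinuousLinearMap.adjoint_inner_right, ← inner_conj_symm, RCLike.enorm_conj]

/-- The Hilbert–Schmidt norm can be computed in any orthonormal basis. -/
theorem hsNormSq_eq_tsum [CompleteSpace H] [CompleteSpace H'] {ι : Type*}
    (e : HilbertBasis ι ℂ H) (A : H →L[ℂ] H') : hsNormSq A = ∑' i, ‖A (e i)‖ₑ ^ 2 := by
  obtain ⟨w', f, -⟩ := exists_hilbertBasis ℂ H'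
  obtain ⟨w, e', -⟩ := exists_hilbertBasis ℂ H
  refine le_antisymm (iSup₂_le fun v b => ?_) ?_
  · rw [tsum_enorm_sq_eq_adjoint b f, tsum_enorm_sq_eq_adjoint e f]
  · rw [tsum_enorm_sq_eq_adjoint e f, ← tsum_enorm_sq_eq_adjoint e' f]
    exact le_iSup₂_of_le w e' le_rfl

end HilbertSchmidt

/-! ### The Hilbert space of square integrable sections of a Hermitian vector bundle -/

section Sections

set_option linter.unusedSectionVars false

variable {M : Type*} [TopologicalSpace M]
  (F : Type*) [NormedAddCommGroup F] [NormedSpace ℂ F]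
  (S : M → Type*) [TopologicalSpace (TotalSpace F S)]
  [∀ x, NormedAddCommGroup (S x)] [∀ x, InnerProductSpace ℂ (S x)]
  [FiberBundle F S] [VectorBundle ℂ F S]

/-- A complex vector bundle `S` with inner products on its fibers is Hermitian if they depend
continuously on the base point. (By polarization, it is enough to look at the norm.) -/
class IsHermitianBundle : Prop where
  continuous_norm : Continuous fun v : TotalSpace F S => ‖v.2‖

variable {S} in
/-- A section is measurable if its components in the local trivializations are measurable. -/
def IsMeasurableSection [MeasurableSpace M] (ψ : ∀ x, S x) : Prop :=
  ∀ x₀ : M, Measurable[_, borel F] fun x : (trivializationAt F S x₀).baseSet =>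
    (trivializationAt F S x₀ ⟨x, ψ x⟩).2

variable {F S}

theorem measurable_of_local {β : Type*} [MeasurableSpace β] [SecondCountableTopology M]
    [MeasurableSpace M] [BorelSpace M] {g : M → β}
    (h : ∀ x₀ : M, Measurable fun x : (trivializationAt F S x₀).baseSet => g x) :
    Measurable g := by
  obtain ⟨T, hT, hU⟩ := TopologicalSpace.countable_cover_nhds
    (f := fun x₀ : M => (trivializationAt F S x₀).baseSet)
    (fun x₀ => (trivializationAt F S x₀).open_baseSet.mem_nhds
      (FiberBundle.mem_baseSet_trivializationAt' x₀))
  intro s hs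
  have : g ⁻¹' s = ⋃ x₀ ∈ T, Subtype.val ''
      ((fun x : (trivializationAt F S x₀).baseSet => g x) ⁻¹' s) := by
    ext x
    have hx : x ∈ ⋃ x₀ ∈ T, (trivializationAt F S x₀).baseSet := hU ▸ Set.mem_univ x
    simp only [Set.mem_iUnion] at hx ⊢
    obtain ⟨x₀, h0, hx⟩ := hx
    constructor
    · intro h
      exact ⟨x₀, h0, ⟨x, hx⟩, h, rfl⟩
    · rintro ⟨_, _, ⟨y, _⟩, h, rfl⟩
      exact h
  rw [this]
  exact .biUnion hT fun x₀ _ => MeasurableSet.subtype_image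
    (trivializationAt F S x₀).open_baseSet.measurableSet (h x₀ hs)

variable [MeasurableSpace M] [BorelSpace M] [SecondCountableTopology M] [FiniteDimensional ℂ F]
  [IsHermitianBundle F S]

theorem IsMeasurableSection.measurable_norm {ψ : ∀ x, S x} (hψ : IsMeasurableSection F ψ) :
    Measurable fun x => ‖ψ x‖ := by
  refine measurable_of_local (F := F) (S := S) fun x₀ => ?_
  set e := trivializationAt F S x₀
  borelize F
  have := FiniteDimensional.proper ℂ F
  let g : e.baseSet × F → ℝ := fun p => ‖(e.toOpenPartialHomeomorph.symm (p.1, p.2)).2‖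
  have hg : Continuous g := by
    refine (IsHermitianBundle.continuous_norm (F := F) (S := S)).comp ?_
    refine e.toOpenPartialHomeomorph.symm.continuousOn.comp_continuous
      (f := fun p : e.baseSet × F => ((p.1 : M), p.2)) (by fun_prop) fun p => ?_
    simp [e.target_eq]
  have h1 : Measurable fun x : e.baseSet => g (x, (e ⟨x, ψ x⟩).2) :=
    hg.measurable.comp (measurable_id.prodMk (hψ x₀))
  convert h1 using 2 with x
  have hx : (⟨x, ψ x⟩ : TotalSpace F S) ∈ e.source := e.mem_source.2 x.2
  have : e.toOpenPartialHomeomorph.symm ((x : M), (e ⟨x, ψ x⟩).2) = ⟨x, ψ x⟩ := by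
    have h2 : e ⟨x, ψ x⟩ = ((x : M), (e ⟨x, ψ x⟩).2) := Prod.ext (e.coe_fst hx) rfl
    rw [← h2]
    exact e.left_inv hx
  simp only [g]
  rw [this]

theorem IsMeasurableSection.add {ψ φ : ∀ x, S x} (hψ : IsMeasurableSection F ψ)
    (hφ : IsMeasurableSection F φ) : IsMeasurableSection F (ψ + φ) := by
  intro x₀
  borelize F
  have := FiniteDimensional.proper ℂ F
  convert (hψ x₀).add (hφ x₀) using 2 with x
  exact ((trivializationAt F S x₀).linear ℂ x.2).map_add _ _

theorem IsMeasurableSection.smul {ψ : ∀ x, S x} (c : ℂ) (hψ : IsMeasurableSection F ψ) :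
    IsMeasurableSection F (c • ψ) := by
  intro x₀
  borelize F
  have := FiniteDimensional.proper ℂ F
  convert (hψ x₀).const_smul c using 2 with x
  exact ((trivializationAt F S x₀).linear ℂ x.2).map_smul _ _

theorem isMeasurableSection_zero : IsMeasurableSection F (0 : ∀ x, S x) := by
  intro x₀
  borelize F
  convert measurable_const (a := (0 : F)) using 2 with x
  exact ((trivializationAt F S x₀).linear ℂ x.2).map_zero

variable (F S) in
/-- The square integrable measurable sections of `S`. -/
def sqIntegrableSections (μ : Measure M) : Submodule ℂ (∀ x, S x) where
  carrier := {ψ | IsMeasurableSection F ψ ∧ ∫⁻ x, ‖ψ x‖ₑ ^ 2 ∂μ < ⊤}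
  zero_mem' := ⟨isMeasurableSection_zero, by simp⟩
  add_mem' := by
    rintro ψ φ ⟨hψ, hψ'⟩ ⟨hφ, hφ'⟩
    refine ⟨hψ.add hφ, ?_⟩
    have hm : Measurable fun x => ‖ψ x‖ₑ ^ 2 := by
      simpa only [ofReal_norm] using hψ.measurable_norm.ennreal_ofReal.pow_const 2
    calc ∫⁻ x, ‖(ψ + φ) x‖ₑ ^ 2 ∂μ
        ≤ ∫⁻ x, 2 * (‖ψ x‖ₑ ^ 2 + ‖φ x‖ₑ ^ 2) ∂μ := lintegral_mono fun x => by
          refine (pow_le_pow_left' (enorm_add_le (ψ x) (φ x)) 2).trans ?_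
          have := ENNReal.rpow_add_le_mul_rpow_add_rpow ‖ψ x‖ₑ ‖φ x‖ₑ (p := 2) one_le_two
          norm_num at this
          exact this
      _ < ⊤ := by
          rw [lintegral_const_mul' _ _ (by simp), lintegral_add_left hm]
          exact ENNReal.mul_lt_top (by simp) (ENNReal.add_lt_top.2 ⟨hψ', hφ'⟩)
  smul_mem' := by
    rintro c ψ ⟨hψ, hψ'⟩
    refine ⟨hψ.smul c, ?_⟩
    simp_rw [Pi.smul_apply, enorm_smul, mul_pow]
    rw [lintegral_const_mul' _ _ (by simp)]
    exact ENNReal.mul_lt_top (by simp) hψ'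

/-- The square integrable measurable sections of `S`, with the inner product
`⟪ψ, φ⟫ = ∫ ⟪ψ x, φ x⟫ dμ(x)`. -/
def SqIntegrableSection (F : Type*) [NormedAddCommGroup F] [NormedSpace ℂ F]
    (S : M → Type*) [TopologicalSpace (TotalSpace F S)]
    [∀ x, NormedAddCommGroup (S x)] [∀ x, InnerProductSpace ℂ (S x)]
    [FiberBundle F S] [VectorBundle ℂ F S] [FiniteDimensional ℂ F] [IsHermitianBundle F S]
    (μ : Measure M) : Type _ :=
  sqIntegrableSections F S μ

variable {μ : Measure M}

instance : AddCommGroup (SqIntegrableSection F S μ) :=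
  inferInstanceAs (AddCommGroup (sqIntegrableSections F S μ))

instance : Module ℂ (SqIntegrableSection F S μ) :=
  inferInstanceAs (Module ℂ (sqIntegrableSections F S μ))

instance : CoeFun (SqIntegrableSection F S μ) fun _ => ∀ x, S x := ⟨fun ψ => ψ.1⟩

theorem SqIntegrableSection.add_apply (ψ φ : SqIntegrableSection F S μ) (x : M) :
    (ψ + φ) x = ψ x + φ x := rfl

theorem SqIntegrableSection.sub_apply (ψ φ : SqIntegrableSection F S μ) (x : M) :
    (ψ - φ) x = ψ x - φ x := rfl

theorem SqIntegrableSection.smul_apply (c : ℂ) (ψ : SqIntegrableSection F S μ) (x : M) :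
    (c • ψ) x = c • ψ x := rfl

theorem SqIntegrableSection.measurable_norm (ψ : SqIntegrableSection F S μ) :
    Measurable fun x => ‖ψ x‖ := ψ.2.1.measurable_norm

theorem SqIntegrableSection.measurable_inner (ψ φ : SqIntegrableSection F S μ) :
    Measurable fun x => ⟪ψ x, φ x⟫_ℂ := by
  have h1 := (ψ + φ).measurable_norm
  have h2 := (ψ - φ).measurable_norm
  have h3 := (ψ - Complex.I • φ).measurable_norm
  have h4 := (ψ + Complex.I • φ).measurable_norm
  simp only [add_apply, sub_apply, smul_apply] at h1 h2 h3 h4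
  simp_rw [inner_eq_sum_norm_sq_div_four (𝕜 := ℂ)]
  have h5 := Complex.measurable_ofReal
  simp only [RCLike.I_to_complex, Complex.coe_algebraMap] at *
  fun_prop

theorem SqIntegrableSection.integrable_norm_sq (ψ : SqIntegrableSection F S μ) :
    Integrable (fun x => ‖ψ x‖ ^ 2) μ := by
  refine ⟨(ψ.measurable_norm.pow_const 2).aestronglyMeasurable, ?_⟩
  simpa [HasFiniteIntegral] using ψ.2.2

theorem SqIntegrableSection.integrable_inner (ψ φ : SqIntegrableSection F S μ) :
    Integrable (fun x => ⟪ψ x, φ x⟫_ℂ) μ := by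
  refine (ψ.integrable_norm_sq.add φ.integrable_norm_sq).mono'
    (ψ.measurable_inner φ).aestronglyMeasurable (ae_of_all _ fun x => ?_)
  refine (norm_inner_le_norm _ _).trans ?_
  simp only [Pi.add_apply]
  nlinarith [sq_nonneg (‖ψ x‖ - ‖φ x‖), sq_nonneg ‖ψ x‖, sq_nonneg ‖φ x‖]

/-- The inner product `∫ ⟪ψ x, φ x⟫ dμ(x)`. -/
abbrev sectionCore (F : Type*) [NormedAddCommGroup F] [NormedSpace ℂ F]
    (S : M → Type*) [TopologicalSpace (TotalSpace F S)]
    [∀ x, NormedAddCommGroup (S x)] [∀ x, InnerProductSpace ℂ (S x)]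
    [FiberBundle F S] [VectorBundle ℂ F S] [FiniteDimensional ℂ F] [IsHermitianBundle F S]
    (μ : Measure M) : PreInnerProductSpace.Core ℂ (SqIntegrableSection F S μ) where
  inner ψ φ := ∫ x, ⟪ψ x, φ x⟫_ℂ ∂μ
  conj_inner_symm ψ φ := by
    rw [← integral_conj]
    simp_rw [inner_conj_symm]
  re_inner_nonneg ψ := by
    simp_rw [inner_self_eq_norm_sq_to_K, ← RCLike.ofReal_pow]
    rw [integral_ofReal, RCLike.ofReal_re]
    exact integral_nonneg fun x => by positivity
  add_left ψ φ χ := by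
    rw [← integral_add (ψ.integrable_inner χ) (φ.integrable_inner χ)]
    simp_rw [SqIntegrableSection.add_apply, inner_add_left]
  smul_left ψ φ c := by
    rw [← integral_const_mul]
    simp_rw [SqIntegrableSection.smul_apply, inner_smul_left]

instance : SeminormedAddCommGroup (SqIntegrableSection F S μ) :=
  @InnerProductSpace.Core.toSeminormedAddCommGroup ℂ _ _ _ _ (sectionCore F S μ)

instance : InnerProductSpace ℂ (SqIntegrableSection F S μ) :=
  InnerProductSpace.ofCore (sectionCore F S μ)

theorem SqIntegrableSection.inner_def (ψ φ : SqIntegrableSection F S μ) :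
    ⟪ψ, φ⟫_ℂ = ∫ x, ⟪ψ x, φ x⟫_ℂ ∂μ := rfl

theorem SqIntegrableSection.enorm_sq (ψ : SqIntegrableSection F S μ) :
    ‖ψ‖ₑ ^ 2 = ∫⁻ x, ‖ψ x‖ₑ ^ 2 ∂μ := by
  have h : ‖ψ‖ ^ 2 = ∫ x, ‖ψ x‖ ^ 2 ∂μ := by
    rw [← inner_self_eq_norm_sq (𝕜 := ℂ), inner_def]
    simp_rw [inner_self_eq_norm_sq_to_K, ← RCLike.ofReal_pow]
    rw [integral_ofReal, RCLike.ofReal_re]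
  rw [← ofReal_norm, ← ENNReal.ofReal_pow (norm_nonneg _), h,
    ofReal_integral_eq_lintegral_ofReal ψ.integrable_norm_sq (ae_of_all _ fun x => by positivity)]
  simp_rw [ENNReal.ofReal_pow (norm_nonneg _), ofReal_norm]

theorem SqIntegrableSection.exists_tendsto (u : ℕ → SqIntegrableSection F S μ)
    (hu : ∀ N n m : ℕ, N ≤ n → N ≤ m → dist (u n) (u m) < (1 / 4 : ℝ) ^ N) :
    ∃ φ, Tendsto u atTop (𝓝 φ) := by
  have hue : ∀ N n m : ℕ, N ≤ n → N ≤ m →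
      ∫⁻ x, ‖u n x - u m x‖ₑ ^ 2 ∂μ ≤ ENNReal.ofReal ((1 / 4 : ℝ) ^ N) ^ 2 := by
    intro N n m hn hm
    have := (u n - u m).enorm_sq
    simp only [sub_apply] at this
    rw [← this]
    gcongr
    rw [← ofReal_norm, ← dist_eq_norm]
    exact ENNReal.ofReal_le_ofReal (hu N n m hn hm).le
  have hmeas : ∀ n m, Measurable fun x => ‖u n x - u m x‖ₑ ^ 2 := fun n m => by
    simpa only [ofReal_norm, sub_apply] using
      (u n - u m).measurable_norm.ennreal_ofReal.pow_const 2
  let G : M → ℝ≥0∞ := fun x => ∑' k, 4 ^ k * ‖u (k + 1) x - u k x‖ₑ ^ 2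
  have hG : Measurable G := Measurable.tsum fun k => (hmeas _ _).const_mul _
  have hGint : ∫⁻ x, G x ∂μ ≠ ⊤ := by
    have h1 : ∫⁻ x, G x ∂μ = ∑' k, 4 ^ k * ∫⁻ x, ‖u (k + 1) x - u k x‖ₑ ^ 2 ∂μ := by
      rw [lintegral_tsum fun k => ((hmeas _ _).const_mul _).aemeasurable]
      exact tsum_congr fun k => lintegral_const_mul _ (hmeas _ _)
    have h2 : ∀ k : ℕ, 4 ^ k * ∫⁻ x, ‖u (k + 1) x - u k x‖ₑ ^ 2 ∂μ
        ≤ ENNReal.ofReal ((1 / 4 : ℝ) ^ k) := fun k => by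
      refine (mul_le_mul_right (hue k (k + 1) k (Nat.le_succ k) le_rfl) _).trans ?_
      have : (4 : ℝ≥0∞) ^ k = ENNReal.ofReal (4 ^ k) := by
        rw [ENNReal.ofReal_pow (by norm_num)]; norm_num
      rw [this, ← ENNReal.ofReal_pow (by positivity), ← ENNReal.ofReal_mul (by positivity)]
      refine ENNReal.ofReal_le_ofReal (le_of_eq ?_)
      rw [one_div, inv_pow]
      field_simp
    rw [h1]
    refine ne_top_of_le_ne_top ?_ (ENNReal.tsum_le_tsum h2)
    exact (summable_geometric_of_lt_one (by norm_num) (by norm_num)).tsum_ofReal_ne_top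
  have hT : MeasurableSet {x | G x < ⊤} := measurableSet_lt hG measurable_const
  have hae : ∀ᵐ x ∂μ, G x < ⊤ := ae_lt_top hG hGint
  have hlim : ∀ x, ∃ v : S x, (G x < ⊤ → Tendsto (fun n => u n x) atTop (𝓝 v)) ∧
      (¬ G x < ⊤ → v = 0) := by
    intro x
    by_cases hx : G x < ⊤
    · have : FiniteDimensional ℂ (S x) :=
        (VectorBundle.continuousLinearEquivAt ℂ F S x).symm.toLinearEquiv.finiteDimensional
      have : CompleteSpace (S x) := FiniteDimensional.complete ℂ (S x)
      have hc : CauchySeq fun n => u n x := by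
        refine cauchySeq_of_le_geometric (1 / 2) (√(G x).toReal) (by norm_num) fun k => ?_
        have h1 : 4 ^ k * ‖u (k + 1) x - u k x‖ₑ ^ 2 ≤ G x :=
          ENNReal.le_tsum (f := fun k => 4 ^ k * ‖u (k + 1) x - u k x‖ₑ ^ 2) k
        have h2 := ENNReal.toReal_mono hx.ne h1
        simp only [ENNReal.toReal_mul, ENNReal.toReal_pow, toReal_enorm,
          ENNReal.toReal_ofNat] at h2
        rw [dist_comm, dist_eq_norm, one_div, inv_pow, ← div_eq_mul_inv, le_div_iff₀ (by positivity)]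
        refine Real.le_sqrt_of_sq_le ?_
        rw [mul_pow, ← pow_mul, mul_comm k, pow_mul]
        norm_num
        linarith
      obtain ⟨v, hv⟩ := cauchySeq_tendsto_of_complete hc
      exact ⟨v, fun _ => hv, fun h => absurd hx h⟩
    · exact ⟨0, fun h => absurd h hx, fun _ => rfl⟩
  choose φ hφ hφ0 using hlim
  have hφm : IsMeasurableSection F φ := by
    intro x₀
    borelize F
    set e := trivializationAt F S x₀
    have hT' : MeasurableSet {x : e.baseSet | G x < ⊤} := measurable_subtype_coe hT
    classical
    refine measurable_of_tendsto_metrizable (f := fun n (x : e.baseSet) =>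
      if G x < ⊤ then (e ⟨x, u n x⟩).2 else 0)
      (fun n => Measurable.ite hT' ((u n).2.1 x₀) measurable_const) ?_
    rw [tendsto_pi_nhds]
    intro x
    have hx : ∀ v : S x, (e ⟨x, v⟩).2 = e.continuousLinearEquivAt ℂ x x.2 v := fun v => rfl
    simp only [hx]
    by_cases h : G x < ⊤
    · simp only [h, if_true]
      exact ((e.continuousLinearEquivAt ℂ x x.2).continuous.tendsto _).comp (hφ x h)
    · simp only [h, if_false, hφ0 x h, map_zero]
      exact tendsto_const_nhds
  have hdist : ∀ N n : ℕ, N ≤ n →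
      ∫⁻ x, ‖u n x - φ x‖ₑ ^ 2 ∂μ ≤ ENNReal.ofReal ((1 / 4 : ℝ) ^ N) ^ 2 := by
    intro N n hn
    calc ∫⁻ x, ‖u n x - φ x‖ₑ ^ 2 ∂μ
        = ∫⁻ x, liminf (fun m => ‖u n x - u m x‖ₑ ^ 2) atTop ∂μ := by
          refine lintegral_congr_ae (hae.mono fun x hx => ?_)
          refine (Tendsto.liminf_eq ?_).symm
          exact ((ENNReal.continuous_pow 2).tendsto _).comp (tendsto_const_nhds.sub (hφ x hx)).enorm
      _ ≤ liminf (fun m => ∫⁻ x, ‖u n x - u m x‖ₑ ^ 2 ∂μ) atTop :=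
          lintegral_liminf_le fun m => hmeas n m
      _ ≤ ENNReal.ofReal ((1 / 4 : ℝ) ^ N) ^ 2 := by
          refine liminf_le_of_frequently_le' (Eventually.frequently ?_)
          filter_upwards [eventually_ge_atTop N] with m hm using hue N n m hn hm
  have hmem : (fun x => u 0 x - φ x) ∈ sqIntegrableSections F S μ := by
    refine ⟨?_, (hdist 0 0 le_rfl).trans_lt (by simp)⟩
    convert (u 0).2.1.add (hφm.smul (-1)) using 1
    funext x
    simp [sub_eq_add_neg]
  have hφmem : φ ∈ sqIntegrableSections F S μ := by
    convert (sqIntegrableSections F S μ).sub_mem (u 0).2 hmem using 1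
    funext x
    simp
  let Φ : SqIntegrableSection F S μ := ⟨φ, hφmem⟩
  refine ⟨Φ, Metric.tendsto_atTop.2 fun ε hε => ?_⟩
  obtain ⟨N, hN⟩ := exists_pow_lt_of_lt_one hε (show (1 / 4 : ℝ) < 1 by norm_num)
  refine ⟨N, fun n hn => lt_of_le_of_lt ?_ hN⟩
  have h1 := (u n - Φ).enorm_sq
  have h2 : ‖u n - Φ‖ₑ ^ 2 ≤ ENNReal.ofReal ((1 / 4 : ℝ) ^ N) ^ 2 := h1.trans_le (hdist N n hn)
  rw [← ofReal_norm, ← ENNReal.ofReal_pow (norm_nonneg _), ← ENNReal.ofReal_pow (by positivity),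
    ENNReal.ofReal_le_ofReal_iff (by positivity)] at h2
  rw [dist_eq_norm]
  exact le_of_sq_le_sq h2 (by positivity)

instance : CompleteSpace (SqIntegrableSection F S μ) :=
  Metric.complete_of_convergent_controlled_sequences (fun n => (1 / 4 : ℝ) ^ n)
    (fun n => by positivity) fun u hu => SqIntegrableSection.exists_tendsto u hu

/-- The Hilbert space `L²(M, S)` of square integrable sections, up to equality almost
everywhere. The class of a section `ψ` is `SeparationQuotient.mk ψ`. -/
abbrev L2 (F : Type*) [NormedAddCommGroup F] [NormedSpace ℂ F]
    (S : M → Type*) [TopologicalSpace (TotalSpace F S)]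
    [∀ x, NormedAddCommGroup (S x)] [∀ x, InnerProductSpace ℂ (S x)]
    [FiberBundle F S] [VectorBundle ℂ F S] [FiniteDimensional ℂ F] [IsHermitianBundle F S]
    (μ : Measure M) : Type _ :=
  SeparationQuotient (SqIntegrableSection F S μ)

end Sections

/-! ### Square integrable kernels -/

section Kernels

variable {M : Type*} [TopologicalSpace M] [MeasurableSpace M] [BorelSpace M]
  [SecondCountableTopology M]

/-- A square integrable kernel, that is, a square integrable section `K` over `M × M` of the bundle
with fiber `Hom (S p', S p)` at `(p, p')`, which carries the Hilbert–Schmidt norm. -/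
structure L2Kernel (F : Type*) [NormedAddCommGroup F] [NormedSpace ℂ F]
    (S : M → Type*) [TopologicalSpace (TotalSpace F S)]
    [∀ x, NormedAddCommGroup (S x)] [∀ x, InnerProductSpace ℂ (S x)]
    [FiberBundle F S] [VectorBundle ℂ F S]
    (μ : Measure M) where
  /-- the kernel -/
  toFun : ∀ p p' : M, S p' →L[ℂ] S p
  measurable_toFun : ∀ φ ψ : ∀ x, S x, IsMeasurableSection F φ → IsMeasurableSection F ψ →
    Measurable fun z : M × M => ⟪φ z.1, toFun z.1 z.2 (ψ z.2)⟫_ℂ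
  lintegral_lt_top : ∫⁻ z, hsNormSq (toFun z.1 z.2) ∂(μ.prod μ) < ⊤

variable {F : Type*} [NormedAddCommGroup F] [NormedSpace ℂ F]
  {S : M → Type*} [TopologicalSpace (TotalSpace F S)]
  [∀ x, NormedAddCommGroup (S x)] [∀ x, InnerProductSpace ℂ (S x)]
  [FiberBundle F S] [VectorBundle ℂ F S]
  {μ : Measure M}

/-- The norm of `K` in `L²(M × M)`. -/
def L2Kernel.l2Norm (K : L2Kernel F S μ) : ℝ≥0∞ :=
  (∫⁻ z, hsNormSq (K.toFun z.1 z.2) ∂(μ.prod μ)) ^ (1 / 2 : ℝ)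

/-- The distance of `K` and `K'` in `L²(M × M)`. -/
def L2Kernel.l2Dist (K K' : L2Kernel F S μ) : ℝ≥0∞ :=
  (∫⁻ z, hsNormSq (K.toFun z.1 z.2 - K'.toFun z.1 z.2) ∂(μ.prod μ)) ^ (1 / 2 : ℝ)

/-- `K` is the kernel of `A`: the operator `A` is `(A ψ)(p) = ∫ K(p, p') ψ(p') dμ(p')`, tested
against the square integrable sections `φ`. -/
def HasKernel [FiniteDimensional ℂ F] [IsHermitianBundle F S]
    (A : L2 F S μ →L[ℂ] L2 F S μ) (K : L2Kernel F S μ) : Prop :=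
  ∀ φ ψ : SqIntegrableSection F S μ,
    ⟪(SeparationQuotient.mk φ : L2 F S μ), A (SeparationQuotient.mk ψ)⟫_ℂ =
      ∫ z, ⟪φ z.1, K.toFun z.1 z.2 (ψ z.2)⟫_ℂ ∂(μ.prod μ)

end Kernels

/-! ### Unitary representations of `ℝˡ` and the twists of an operator -/

section Twists

/-- A strongly continuous unitary representation `z ↦ V z` of `ℝˡ` on `H`. -/
structure UnitaryRep (l : ℕ) (H : Type*) [NormedAddCommGroup H] [InnerProductSpace ℂ H] where
  /-- the unitary operators -/
  toFun : EuclideanSpace ℝ (Fin l) → (H ≃ₗᵢ[ℂ] H)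
  map_add : ∀ (z w : EuclideanSpace ℝ (Fin l)) (ψ : H), toFun (z + w) ψ = toFun z (toFun w ψ)
  continuous_apply : ∀ ψ : H, Continuous fun z => toFun z ψ

variable {l : ℕ} {H : Type*} [NormedAddCommGroup H] [InnerProductSpace ℂ H]

instance : CoeFun (UnitaryRep l H) fun _ => EuclideanSpace ℝ (Fin l) → (H ≃ₗᵢ[ℂ] H) :=
  ⟨UnitaryRep.toFun⟩

/-- `½ Θ y`. -/
def halfMul (Θ : Matrix (Fin l) (Fin l) ℝ) (y : EuclideanSpace ℝ (Fin l)) :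
    EuclideanSpace ℝ (Fin l) :=
  (1 / 2 : ℝ) • Matrix.toEuclideanLin Θ y

/-- The oscillatory integral `(2π)⁻ˡ ∫∫ e^{-i⟪y, z⟫} a(y, z) dy dz` exists and has the value `v`:
the absolutely convergent integrals in which a factor `χ(εy, εz)` is inserted converge to `v` as
`ε ↓ 0`, for every Schwartz function `χ` with `χ(0) = 1`. -/
def HasOscIntegral (a : EuclideanSpace ℝ (Fin l) → EuclideanSpace ℝ (Fin l) → H) (v : H) : Prop :=
  ∀ χ : 𝓢(EuclideanSpace ℝ (Fin l) × EuclideanSpace ℝ (Fin l), ℂ), χ 0 = 1 →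
    Tendsto (fun ε : ℝ => (((2 * Real.pi) ^ l)⁻¹ : ℝ) •
        ∫ w : EuclideanSpace ℝ (Fin l) × EuclideanSpace ℝ (Fin l),
          (χ (ε • w) * Complex.exp (-Complex.I * (⟪w.1, w.2⟫_ℝ : ℝ))) • a w.1 w.2)
      (𝓝[>] 0) (𝓝 v)

/-- `L = (2π)⁻ˡ ∫∫ e^{-i⟪y, z⟫} V_{½Θy} A V_{-½Θy-z} dy dz`, as a strongly convergent
oscillatory integral. -/
def IsLeftTwist (V : UnitaryRep l H) (Θ : Matrix (Fin l) (Fin l) ℝ) (A L : H →L[ℂ] H) : Prop :=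
  ∀ ψ : H, HasOscIntegral (fun y z => V (halfMul Θ y) (A (V (-halfMul Θ y - z) ψ))) (L ψ)

/-- `R = (2π)⁻ˡ ∫∫ e^{-i⟪y, z⟫} V_{-z} A V_{z+½Θy} dy dz`, as a strongly convergent
oscillatory integral. -/
def IsRightTwist (V : UnitaryRep l H) (Θ : Matrix (Fin l) (Fin l) ℝ) (A R : H →L[ℂ] H) : Prop :=
  ∀ ψ : H, HasOscIntegral (fun y z => V (-z) (A (V (z + halfMul Θ y) ψ))) (R ψ)

open Classical in
/-- The left twist `L_A` (and `0` if the integral that defines it does not converge). -/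
def leftTwist (V : UnitaryRep l H) (Θ : Matrix (Fin l) (Fin l) ℝ) (A : H →L[ℂ] H) : H →L[ℂ] H :=
  if h : ∃ L, IsLeftTwist V Θ A L then h.choose else 0

open Classical in
/-- The right twist `R_A` (and `0` if the integral that defines it does not converge). -/
def rightTwist (V : UnitaryRep l H) (Θ : Matrix (Fin l) (Fin l) ℝ) (A : H →L[ℂ] H) : H →L[ℂ] H :=
  if h : ∃ R, IsRightTwist V Θ A R then h.choose else 0

end Twists

/-! ### Riemannian volume, and unitary operators that cover an action -/

section Geometry

variable {n : ℕ} {M : Type*} [EMetricSpace M] [ChartedSpace (EuclideanSpace ℝ (Fin n)) M]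
  [IsManifold (𝓡 n) ∞ M]

/-- The Gram matrix `g_ij = g(∂_i, ∂_j)` of the Riemannian metric in the chart `c`, at the point
with the coordinates `u`. -/
def metricMatrix [RiemannianBundle (fun x : M => TangentSpace (𝓡 n) x)]
    (c : OpenPartialHomeomorph M (EuclideanSpace ℝ (Fin n)))
    (u : EuclideanSpace ℝ (Fin n)) : Matrix (Fin n) (Fin n) ℝ :=
  Matrix.of fun i j =>
    ⟪(mfderiv (𝓡 n) (𝓡 n) c.symm u (EuclideanSpace.single i (1 : ℝ)) :
        TangentSpace (𝓡 n) (c.symm u)),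
      (mfderiv (𝓡 n) (𝓡 n) c.symm u (EuclideanSpace.single j (1 : ℝ)) :
        TangentSpace (𝓡 n) (c.symm u))⟫_ℝ

/-- `μ` is the Riemannian volume: it is `√(det g_ij) du` in every chart. -/
def IsRiemannianVolume [RiemannianBundle (fun x : M => TangentSpace (𝓡 n) x)]
    [MeasurableSpace M] (μ : Measure M) : Prop :=
  ∀ c ∈ IsManifold.maximalAtlas (𝓡 n) ∞ M, ∀ s ⊆ c.source, MeasurableSet s →
    μ s = ∫⁻ u in c '' s, ENNReal.ofReal √(metricMatrix c u).det

/-- `V z (f ψ) = (α_z f) (V z ψ)` for `f` smooth with compact support and `ψ` in `L²(M, S)`, where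
`(α_z f)(p) = f((-z) · p)`. Here `ψ'` and `φ'` are the sections `f ψ` and `(α_z f) φ`. -/
def CoversAction {l : ℕ} [AddAction (EuclideanSpace ℝ (Fin l)) M] [MeasurableSpace M]
    [BorelSpace M] [SecondCountableTopology M]
    {F : Type*} [NormedAddCommGroup F] [NormedSpace ℂ F] [FiniteDimensional ℂ F]
    {S : M → Type*} [TopologicalSpace (TotalSpace F S)]
    [∀ x, NormedAddCommGroup (S x)] [∀ x, InnerProductSpace ℂ (S x)]
    [FiberBundle F S] [VectorBundle ℂ F S] [IsHermitianBundle F S]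
    {μ : Measure M} (V : UnitaryRep l (L2 F S μ)) : Prop :=
  ∀ (z : EuclideanSpace ℝ (Fin l)) (f : M → ℂ), ContMDiff (𝓡 n) 𝓘(ℝ, ℂ) ∞ f →
    HasCompactSupport f → ∀ ψ φ ψ' φ' : SqIntegrableSection F S μ,
      (∀ p, ψ' p = f p • ψ p) → (∀ p, φ' p = f (-z +ᵥ p) • φ p) →
        V z (SeparationQuotient.mk ψ) = SeparationQuotient.mk φ →
          V z (SeparationQuotient.mk ψ') = SeparationQuotient.mk φ'

end Geometry

end TwistedHS
end

/-!
Everything takes place in the Hilbert space `𝒦` of the Hilbert–Schmidt operators on `L²(M, S)`. On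
it, `ℝˡ × ℝˡ` acts by `A ↦ V (a w) A V (b w)`, for linear maps `a` and `b` into `ℝˡ`, and both
twists are oscillatory integrals `(2π)⁻ˡ ∫∫ e^{-i⟪y, z⟫} U(y, z) dy dz` of such a representation
`U`, applied to `A`. The action is isometric, and it is strongly continuous for the Hilbert–Schmidt norm
(`HSModel.exists_rep`). So the theorem reduces to a fact about any strongly continuous unitary
representation `U` of `ℝˡ × ℝˡ`: the oscillatory integral converges strongly to an isometry
(`IsometricRep.exists_linearIsometry_hasOscIntegral`).

The reason is that, in a joint spectral representation, `U(y, z)` is multiplication with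
`e^{i(⟪a, y⟫ + ⟪b, z⟫)}`, and the oscillatory integral is multiplication with its value
`e^{i⟪a, b⟫}`, of modulus one. The full spectral theorem is not needed. The spectral measure `ν` of
one vector `ξ`, which Bochner's theorem provides (`IsometricRep.exists_charFun_eq`), gives the norm
of `∫ h(w) U(w) ξ dw` as an `L²(ν)`-norm of the Fourier transform of `h`
(`IsometricRep.norm_integral_smul_sq_eq`). For the weight `h` of a regularized integral, this
transform is bounded uniformly in `ε` (`exists_norm_oscMultiplier_le`) and tends to
`(2π)ˡ e^{i⟪a, b⟫}` pointwise (`tendsto_oscMultiplier`). By dominated convergence in `L²(ν)`, the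
regularized integrals of `ξ` are Cauchy, their limit does not depend on the cut-off function, and it
has the norm of `ξ`. Bochner's theorem comes from the positivity of the Fourier transform of
`⟪ξ, U x ξ⟫` times a Gaussian (`IsometricRep.fourier_gaussian_mul`), Fourier inversion, and
Prokhorov's theorem.

For the kernels, a measurable orthonormal frame of `S` (`exists_measurable_orthonormal_frame`)
identifies the square integrable kernels with an `L²` space of matrix valued functions on `M × M`.
The kernels `|φ(p)⟩⟨ψ(p')|` are total in it and have the inner products of elementary tensors
(`OrthonormalFrame.tensorModel`), so that it is the Hilbert tensor product of `L²(M, S)` with its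
conjugate, that is, the space of the Hilbert–Schmidt operators (`TensorModel.hsModel`). Fubini's
theorem applies since a Riemannian volume is `σ`-finite (`IsRiemannianVolume.sigmaFinite`).
-/

set_option linter.unusedSectionVars false

noncomputable section

namespace TwistedHS

/-! ### Positive definite functions and Bochner's theorem -/

section Bochner

open FourierTransform Real in
/-- A continuous integrable function with nonnegative Fourier transform has an integrable Fourier
transform: this follows from Gaussian summability at `0` and Fatou's lemma. -/
theorem integrable_fourier_of_nonneg {E : Type*} [NormedAddCommGroup E] [InnerProductSpace ℝ E]
    [FiniteDimensional ℝ E] [MeasurableSpace E] [BorelSpace E] {f : E → ℂ} (hf : Integrable f)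
    (hc : ContinuousAt f 0) {p : E → ℝ} (hp : ∀ k, 0 ≤ p k) (hfp : ∀ k, 𝓕 f k = (p k : ℂ)) :
    Integrable (𝓕 f) := by
  have hFc : Continuous (𝓕 f) :=
    VectorFourier.fourierIntegral_continuous Real.continuous_fourierChar
      (by exact continuous_inner) hf
  have hpc : Continuous p := by
    have : p = fun k => (𝓕 f k).re := by funext k; rw [hfp]; simp
    rw [this]; fun_prop
  -- the Gaussian means of the integral of `𝓕 f` converge to `f 0`
  have hA : Tendsto (fun c : ℝ => ∫ w : E, Complex.exp (-c⁻¹ * ‖w‖ ^ 2) • 𝓕 f w) atTop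
      (𝓝 (f 0)) := by
    refine (Real.tendsto_integral_gaussian_smul' hf hc).congr' ?_
    filter_upwards [Ioi_mem_atTop 0] with c (hc : 0 < c)
    have J : Integrable (fun w : E ↦ Complex.exp (-c⁻¹ * ‖w‖ ^ 2)) := by
      simpa using GaussianFourier.integrable_cexp_neg_mul_sq_norm_add (V := E) (b := (c⁻¹ : ℝ))
        (by simpa using hc) 0 0
    have h1 : ∫ w, 𝓕 (fun w : E ↦ Complex.exp (-c⁻¹ * ‖w‖ ^ 2)) w • f w =
        ∫ w, Complex.exp (-c⁻¹ * ‖w‖ ^ 2) • 𝓕 f w := by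
      simpa using! (VectorFourier.integral_fourierIntegral_smul_eq_flip (L := innerₗ E)
        Real.continuous_fourierChar continuous_inner J hf)
    rw [← h1]
    congr with w
    have h2 := fourier_gaussian_innerProductSpace' (V := E) (b := (c⁻¹ : ℝ)) (by simpa using hc) 0 w
    simp only [inner_zero_left, Complex.ofReal_zero, mul_zero, add_zero] at h2
    rw [h2]
    rw [Complex.ofReal_inv, div_inv_eq_mul, div_inv_eq_mul,
      show -(π : ℂ) ^ 2 * ‖0 - w‖ ^ 2 * c = -π ^ 2 * c * ‖0 - w‖ ^ 2 by ring]
  have hint : ∀ c : ℝ, 0 < c → Integrable fun w : E => Real.exp (-c⁻¹ * ‖w‖ ^ 2) * p w := by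
    intro c hc
    have J : Integrable (fun w : E ↦ Complex.exp (-c⁻¹ * ‖w‖ ^ 2)) := by
      simpa using GaussianFourier.integrable_cexp_neg_mul_sq_norm_add (V := E) (b := (c⁻¹ : ℝ))
        (by simpa using hc) 0 0
    have hb : ∀ w, ‖𝓕 f w‖ ≤ ∫ v, ‖f v‖ := fun w =>
      VectorFourier.norm_fourierIntegral_le_integral_norm _ _ _ _ _
    have := (J.mul_bdd (c := ∫ v, ‖f v‖) hFc.aestronglyMeasurable (ae_of_all _ hb)).re
    refine this.congr (ae_of_all _ fun w => ?_)
    simp only [hfp]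
    rw [show (-((c⁻¹ : ℝ) : ℂ) * (‖w‖ : ℂ) ^ 2) = ((-c⁻¹ * ‖w‖ ^ 2 : ℝ) : ℂ) by push_cast; ring,
      ← Complex.ofReal_exp, ← Complex.ofReal_mul]
    exact Complex.ofReal_re _
  have hlim : Tendsto (fun n : ℕ => ∫⁻ w : E, ENNReal.ofReal
      (Real.exp (-((n : ℝ) + 1)⁻¹ * ‖w‖ ^ 2) * p w)) atTop (𝓝 (ENNReal.ofReal (f 0).re)) := by
    have h1 : Tendsto (fun n : ℕ => ((n : ℝ) + 1)) atTop atTop :=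
      tendsto_atTop_add_const_right _ _ tendsto_natCast_atTop_atTop
    have h2 := ENNReal.tendsto_ofReal ((Complex.continuous_re.tendsto _).comp (hA.comp h1))
    refine h2.congr fun n => ?_
    rw [← ofReal_integral_eq_lintegral_ofReal (hint _ (by positivity))
      (ae_of_all _ fun w => mul_nonneg (Real.exp_pos _).le (hp w))]
    congr 1
    simp only [Function.comp_apply, hfp]
    rw [← Complex.ofReal_re (∫ w : E, Real.exp (-((n : ℝ) + 1)⁻¹ * ‖w‖ ^ 2) * p w),
      ← integral_complex_ofReal]
    simp
  refine ⟨hFc.aestronglyMeasurable, ?_⟩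
  have h3 : ∫⁻ w : E, ENNReal.ofReal (p w) ≤ ENNReal.ofReal (f 0).re := by
    rw [← hlim.liminf_eq]
    refine le_trans (le_of_eq ?_) (lintegral_liminf_le fun n => by fun_prop)
    congr with w
    refine (Tendsto.liminf_eq ?_).symm
    refine ENNReal.tendsto_ofReal ?_
    have h1 : Tendsto (fun n : ℕ => ((n : ℝ) + 1)⁻¹) atTop (𝓝 0) := by
      simpa using tendsto_one_div_add_atTop_nhds_zero_nat (𝕜 := ℝ)
    have : Tendsto (fun n : ℕ => Real.exp (-((n : ℝ) + 1)⁻¹ * ‖w‖ ^ 2) * p w) atTop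
        (𝓝 (Real.exp (-0 * ‖w‖ ^ 2) * p w)) :=
      ((Real.continuous_exp.tendsto _).comp (h1.neg.mul_const _)).mul_const _
    simpa using this
  refine lt_of_le_of_lt (le_trans (le_of_eq ?_) h3) ENNReal.ofReal_lt_top
  congr with w
  rw [hfp, ← ofReal_norm, Complex.norm_real, Real.norm_of_nonneg (hp w)]

end Bochner

/-- A strongly continuous representation `x ↦ U x` of an additive group by linear isometries. Since
`U 0` is an idempotent isometry, it is the identity, and the `U x` are in fact unitary. -/
structure IsometricRep (G K : Type*) [AddCommGroup G] [TopologicalSpace G] [NormedAddCommGroup K]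
    [InnerProductSpace ℂ K] where
  /-- the isometries -/
  toFun : G → (K →ₗᵢ[ℂ] K)
  map_add : ∀ (z w : G) (ξ : K), toFun (z + w) ξ = toFun z (toFun w ξ)
  continuous_apply : ∀ ξ : K, Continuous fun z => toFun z ξ

namespace IsometricRep

section Basic

variable {G K : Type*} [AddCommGroup G] [TopologicalSpace G] [NormedAddCommGroup K]
    [InnerProductSpace ℂ K]

instance : CoeFun (IsometricRep G K) fun _ => G → (K →ₗᵢ[ℂ] K) := ⟨toFun⟩

theorem zero_apply (U : IsometricRep G K) (ξ : K) : U 0 ξ = ξ := by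
  apply (U 0).injective
  rw [← U.map_add, add_zero]

theorem inner_apply_apply (U : IsometricRep G K) (u w : G) (ξ : K) :
    ⟪U u ξ, U w ξ⟫_ℂ = ⟪ξ, U (w - u) ξ⟫_ℂ := by
  conv_lhs => rw [← add_sub_cancel u w, U.map_add]
  exact (U u).inner_map_map _ _

theorem continuous_inner_apply (U : IsometricRep G K) (ξ : K) :
    Continuous fun z => ⟪ξ, U z ξ⟫_ℂ := continuous_const.inner (U.continuous_apply ξ)

variable [MeasurableSpace G] [OpensMeasurableSpace G] [SecondCountableTopology G] {m : Measure G}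

theorem integrable_smul (U : IsometricRep G K) {h : G → ℂ} (hh : Integrable h m) (ξ : K) :
    Integrable (fun w => h w • U w ξ) m := by
  refine (hh.norm.mul_const ‖ξ‖).mono'
    (hh.aestronglyMeasurable.smul (U.continuous_apply ξ).aestronglyMeasurable)
    (ae_of_all _ fun w => ?_)
  rw [norm_smul, (U w).norm_map]

/-- The squared norm of an integral of translates of `ξ`, as a double integral of the matrix
coefficient `⟪ξ, U x ξ⟫`. -/
theorem norm_integral_smul_sq [CompleteSpace K] (U : IsometricRep G K) {h : G → ℂ}
    (hh : Integrable h m) (ξ : K) :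
    ((‖∫ w, h w • U w ξ ∂m‖ ^ 2 : ℝ) : ℂ) =
      ∫ u, ∫ w, starRingEnd ℂ (h u) * h w * ⟪ξ, U (w - u) ξ⟫_ℂ ∂m ∂m := by
  have hi := U.integrable_smul hh ξ
  rw [Complex.ofReal_pow, ← Complex.coe_algebraMap, ← inner_self_eq_norm_sq_to_K (𝕜 := ℂ),
    ← inner_conj_symm, ← integral_inner hi, ← integral_conj]
  congr with u
  rw [inner_conj_symm, ← integral_inner hi]
  congr with w
  rw [inner_smul_left, inner_smul_right, inner_apply_apply]
  ring

end Basic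

section Bochner

variable {E K : Type*} [NormedAddCommGroup E] [InnerProductSpace ℝ E]
  [FiniteDimensional ℝ E] [MeasurableSpace E] [BorelSpace E] [NormedAddCommGroup K]
  [InnerProductSpace ℂ K] [CompleteSpace K]

open FourierTransform Real

theorem integrable_rexp_neg_mul_norm_sq {b : ℝ} (hb : 0 < b) :
    Integrable fun w : E => rexp (-b * ‖w‖ ^ 2) := by
  have := (GaussianFourier.integrable_cexp_neg_mul_sq_norm_add (V := E) (b := (b : ℂ))
        (by simpa using hb) 0 0).re
  refine this.congr (ae_of_all _ fun w => ?_)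
  simp only [zero_mul, add_zero]
  rw [show (-(b : ℂ) * (‖w‖ : ℂ) ^ 2) = ((-b * ‖w‖ ^ 2 : ℝ) : ℂ) by push_cast; ring,
    ← Complex.ofReal_exp]
  exact Complex.ofReal_re _

/-- Multiplied by a Gaussian, a diagonal matrix coefficient of a representation has a nonnegative
Fourier transform: it is, up to a constant, the squared norm of a vector. -/
theorem fourier_gaussian_mul (U : IsometricRep E K) (ξ : K) {b : ℝ} (hb : 0 < b) (k : E) :
    ((∫ u : E, rexp (-(2 * b) * ‖u‖ ^ 2) : ℝ) : ℂ) *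
        𝓕 (fun x : E => (rexp (-(b / 2) * ‖x‖ ^ 2) : ℂ) * ⟪ξ, U x ξ⟫_ℂ) k =
      ((‖∫ w : E, ((rexp (-b * ‖w‖ ^ 2) : ℂ) * (𝐞 (-⟪w, k⟫_ℝ) : ℂ)) • U w ξ‖ ^ 2 : ℝ) : ℂ) := by
  have hg := integrable_rexp_neg_mul_norm_sq (E := E) hb
  have hh : Integrable fun w : E => (rexp (-b * ‖w‖ ^ 2) : ℂ) * (𝐞 (-⟪w, k⟫_ℝ) : ℂ) :=
    hg.ofReal.mul_bdd (c := 1) (by fun_prop)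
      (ae_of_all _ fun w => (Circle.norm_coe _).le)
  rw [U.norm_integral_smul_sq hh]
  have h1 : ∀ u x : E, starRingEnd ℂ ((rexp (-b * ‖u‖ ^ 2) : ℂ) * (𝐞 (-⟪u, k⟫_ℝ) : ℂ)) *
      ((rexp (-b * ‖u + x‖ ^ 2) : ℂ) * (𝐞 (-⟪u + x, k⟫_ℝ) : ℂ)) * ⟪ξ, U (u + x - u) ξ⟫_ℂ =
      (rexp (-(2 * b) * ‖u + (1 / 2 : ℝ) • x‖ ^ 2) : ℂ) *
        ((𝐞 (-⟪x, k⟫_ℝ) : ℂ) * ((rexp (-(b / 2) * ‖x‖ ^ 2) : ℂ) * ⟪ξ, U x ξ⟫_ℂ)) := by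
    intro u x
    have e1 : rexp (-b * ‖u‖ ^ 2) * rexp (-b * ‖u + x‖ ^ 2) =
        rexp (-(2 * b) * ‖u + (1 / 2 : ℝ) • x‖ ^ 2) * rexp (-(b / 2) * ‖x‖ ^ 2) := by
      rw [← Real.exp_add, ← Real.exp_add, norm_add_sq_real, norm_add_sq_real, norm_smul,
        inner_smul_right]
      congr 1
      norm_num
      ring
    have e2 : starRingEnd ℂ (𝐞 (-⟪u, k⟫_ℝ) : ℂ) * (𝐞 (-⟪u + x, k⟫_ℝ) : ℂ) =
        (𝐞 (-⟪x, k⟫_ℝ) : ℂ) := by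
      rw [inner_add_left, neg_add, AddChar.map_add_eq_mul, Circle.coe_mul, ← mul_assoc,
        ← Complex.normSq_eq_conj_mul_self]
      simp
    rw [map_mul, Complex.conj_ofReal, add_sub_cancel_left]
    have e1' := congrArg (fun r : ℝ => (r : ℂ)) e1
    simp only [Complex.ofReal_mul] at e1'
    linear_combination (starRingEnd ℂ (𝐞 (-⟪u, k⟫_ℝ) : ℂ) * (𝐞 (-⟪u + x, k⟫_ℝ) : ℂ)) *
      ⟪ξ, U x ξ⟫_ℂ * e1' + (rexp (-(2 * b) * ‖u + (1 / 2 : ℝ) • x‖ ^ 2) : ℂ) *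
      (rexp (-(b / 2) * ‖x‖ ^ 2) : ℂ) * ⟪ξ, U x ξ⟫_ℂ * e2
  have h2 : ∀ u : E, ∫ w, starRingEnd ℂ ((rexp (-b * ‖u‖ ^ 2) : ℂ) * (𝐞 (-⟪u, k⟫_ℝ) : ℂ)) *
      ((rexp (-b * ‖w‖ ^ 2) : ℂ) * (𝐞 (-⟪w, k⟫_ℝ) : ℂ)) * ⟪ξ, U (w - u) ξ⟫_ℂ =
      ∫ x, (rexp (-(2 * b) * ‖u + (1 / 2 : ℝ) • x‖ ^ 2) : ℂ) *
        ((𝐞 (-⟪x, k⟫_ℝ) : ℂ) * ((rexp (-(b / 2) * ‖x‖ ^ 2) : ℂ) * ⟪ξ, U x ξ⟫_ℂ)) := by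
    intro u
    rw [← integral_add_left_eq_self _ u]
    simp_rw [h1]
  simp_rw [h2]
  have hUc := U.continuous_inner_apply ξ
  rw [integral_integral_swap]
  · have h3 : ∀ x : E, ∫ u, (rexp (-(2 * b) * ‖u + (1 / 2 : ℝ) • x‖ ^ 2) : ℂ) *
        ((𝐞 (-⟪x, k⟫_ℝ) : ℂ) * ((rexp (-(b / 2) * ‖x‖ ^ 2) : ℂ) * ⟪ξ, U x ξ⟫_ℂ)) =
        ((∫ u : E, rexp (-(2 * b) * ‖u‖ ^ 2) : ℝ) : ℂ) *
        ((𝐞 (-⟪x, k⟫_ℝ) : ℂ) * ((rexp (-(b / 2) * ‖x‖ ^ 2) : ℂ) * ⟪ξ, U x ξ⟫_ℂ)) := by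
      intro x
      rw [integral_mul_const, integral_add_right_eq_self
        (fun u : E => (rexp (-(2 * b) * ‖u‖ ^ 2) : ℂ)), integral_complex_ofReal]
    simp_rw [h3]
    rw [integral_const_mul, Real.fourier_eq]
    simp only [Circle.smul_def, smul_eq_mul]
  · have hb1 := integrable_rexp_neg_mul_norm_sq (E := E) (half_pos hb)
    have hb2 := integrable_rexp_neg_mul_norm_sq (E := E) (half_pos (half_pos hb))
    refine ((hb1.mul_prod hb2).mul_const (‖ξ‖ * ‖ξ‖)).mono' ?_ (ae_of_all _ fun p => ?_)
    · refine Continuous.aestronglyMeasurable ?_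
      have hU2 : Continuous fun p : E × E => ⟪ξ, U p.2 ξ⟫_ℂ := hUc.comp continuous_snd
      simp only [Function.uncurry_def]
      refine Continuous.mul (by fun_prop) (Continuous.mul (by fun_prop)
        (Continuous.mul (by fun_prop) hU2))
    · obtain ⟨u, x⟩ := p
      simp only [Function.uncurry_apply_pair, norm_mul, Circle.norm_coe, one_mul,
        Complex.norm_real, Real.norm_eq_abs, Real.abs_exp]
      rw [← mul_assoc]
      refine mul_le_mul ?_ ?_ (norm_nonneg _) (by positivity)
      · -- `2 ‖u + x / 2‖² + ‖x‖² / 2 = ‖u‖² / 2 + ‖x‖² / 4 + ‖3 u + 2 x‖² / 6 + ‖x‖² / 12`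
        rw [← Real.exp_add, ← Real.exp_add]
        apply Real.exp_le_exp.2
        have e := norm_add_sq_real u ((1 / 2 : ℝ) • x)
        rw [norm_smul, inner_smul_right] at e
        norm_num at e
        have e4 := norm_add_sq_real ((3 : ℝ) • u) ((2 : ℝ) • x)
        have e5 := sq_nonneg ‖(3 : ℝ) • u + (2 : ℝ) • x‖
        rw [e4, norm_smul, norm_smul, real_inner_smul_left, inner_smul_right] at e5
        norm_num at e5
        norm_num
        rw [e]
        nlinarith [mul_nonneg hb.le e5, mul_nonneg hb.le (sq_nonneg ‖x‖)]
      · refine (norm_inner_le_norm _ _).trans ?_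
        rw [(U x).norm_map]

end Bochner

end IsometricRep

namespace IsometricRep

section BochnerMeasure

variable {E K : Type*} [NormedAddCommGroup E] [InnerProductSpace ℝ E]
  [FiniteDimensional ℝ E] [MeasurableSpace E] [BorelSpace E] [NormedAddCommGroup K]
  [InnerProductSpace ℂ K] [CompleteSpace K]

open FourierTransform Real

/-- A Gaussian times `x ↦ ⟪ξ, U x ξ⟫` is a characteristic function: its Fourier transform is
nonnegative and integrable, and serves as the density of the measure. -/
theorem exists_charFun_eq_gaussian_mul (U : IsometricRep E K) {ξ : K} (hξ : ‖ξ‖ = 1) {b : ℝ}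
    (hb : 0 < b) : ∃ ν : ProbabilityMeasure E, ∀ x,
      charFun (ν : Measure E) x = (rexp (-(b / 2) * ‖x‖ ^ 2) : ℂ) * ⟪ξ, U x ξ⟫_ℂ := by
  set f : E → ℂ := fun x => (rexp (-(b / 2) * ‖x‖ ^ 2) : ℂ) * ⟪ξ, U x ξ⟫_ℂ with hf
  set C : ℝ := ∫ u : E, rexp (-(2 * b) * ‖u‖ ^ 2) with hC
  have hC0 : 0 < C := by
    rw [hC, GaussianFourier.integral_rexp_neg_mul_sq_norm (by positivity)]
    positivity
  let p : E → ℝ := fun k => C⁻¹ *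
    ‖∫ w : E, ((rexp (-b * ‖w‖ ^ 2) : ℂ) * (𝐞 (-⟪w, k⟫_ℝ) : ℂ)) • U w ξ‖ ^ 2
  have hp : ∀ k, 0 ≤ p k := fun k => by positivity
  have hfp : ∀ k, 𝓕 f k = (p k : ℂ) := by
    intro k
    have := U.fourier_gaussian_mul ξ hb k
    simp only [p]
    rw [Complex.ofReal_mul, ← this, ← mul_assoc, ← Complex.ofReal_mul, inv_mul_cancel₀ hC0.ne']
    simp [hf]
  have hUc := U.continuous_inner_apply ξ
  have hfc : Continuous f := Continuous.mul (by fun_prop) hUc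
  have hfi : Integrable f := by
    refine (integrable_rexp_neg_mul_norm_sq (half_pos hb)).ofReal.mul_bdd (c := ‖ξ‖ * ‖ξ‖)
      hUc.aestronglyMeasurable (ae_of_all _ fun x => ?_)
    refine (norm_inner_le_norm _ _).trans ?_
    rw [(U x).norm_map]
  have hFi := integrable_fourier_of_nonneg hfi hfc.continuousAt hp hfp
  have hpi : Integrable p := by
    refine hFi.re.congr (ae_of_all _ fun k => ?_)
    simp only [hfp]
    exact Complex.ofReal_re _
  have hpm : AEMeasurable (fun k => ENNReal.ofReal (p k)) (volume : Measure E) :=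
    hpi.aestronglyMeasurable.aemeasurable.ennreal_ofReal
  let ν₀ : Measure E := volume.withDensity fun k => ENNReal.ofReal (p k)
  -- `charFun` has no factor `2π` in the exponent, unlike `𝓕`
  let ν : Measure E := ν₀.map fun k => (2 * π) • k
  have hfin : IsFiniteMeasure ν₀ := isFiniteMeasure_withDensity_ofReal hpi.2
  have hchar : ∀ x, charFun ν x = f x := by
    intro x
    rw [charFun_apply, integral_map (by fun_prop)
      (Continuous.aestronglyMeasurable (by fun_prop)),
      integral_withDensity_eq_integral_toReal_smul₀ hpm (ae_of_all _ fun k => by simp),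
      ← congrFun (hfc.fourierInv_fourier_eq hfi hFi) x, Real.fourierInv_eq']
    congr with k
    rw [hfp, ENNReal.toReal_ofReal (hp k), real_inner_smul_left, smul_eq_mul, mul_comm,
      Complex.real_smul, mul_comm]
  have hprob : IsProbabilityMeasure ν := by
    have h0 := hchar 0
    rw [charFun_zero] at h0
    simp only [hf, norm_zero, zero_apply, inner_self_eq_norm_sq_to_K, hξ] at h0
    norm_num at h0
    have h1 : ν.real Set.univ = 1 := by exact_mod_cast h0
    refine ⟨?_⟩
    rw [Measure.real, ENNReal.toReal_eq_one_iff] at h1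
    exact h1
  exact ⟨⟨ν, hprob⟩, hchar⟩

/-- Bochner's theorem for the unit vector `ξ`: the positive definite function `x ↦ ⟪ξ, U x ξ⟫` is
the characteristic function of a probability measure, namely of a limit point of the measures with
the characteristic functions `exp (- ‖x‖ ^ 2 / n) * ⟪ξ, U x ξ⟫`. -/
theorem exists_probabilityMeasure_charFun_eq (U : IsometricRep E K) {ξ : K} (hξ : ‖ξ‖ = 1) :
    ∃ ν : ProbabilityMeasure E, ∀ x, charFun (ν : Measure E) x = ⟪ξ, U x ξ⟫_ℂ := by
  have hpos : ∀ n : ℕ, (0 : ℝ) < ((n : ℝ) + 1)⁻¹ := fun n => by positivity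
  choose ν hν using fun n : ℕ => U.exists_charFun_eq_gaussian_mul hξ (hpos n)
  have hlim : ∀ x, Tendsto (fun n => charFun (ν n : Measure E) x) atTop (𝓝 ⟪ξ, U x ξ⟫_ℂ) := by
    intro x
    have h1 : Tendsto (fun n : ℕ => ((n : ℝ) + 1)⁻¹) atTop (𝓝 0) := by
      simpa using tendsto_one_div_add_atTop_nhds_zero_nat (𝕜 := ℝ)
    have h2 : Tendsto (fun n : ℕ => (rexp (-(((n : ℝ) + 1)⁻¹ / 2) * ‖x‖ ^ 2) : ℂ)) atTop
        (𝓝 (rexp (-(0 / 2) * ‖x‖ ^ 2) : ℂ)) :=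
      (Complex.continuous_ofReal.tendsto _).comp
        ((Real.continuous_exp.tendsto _).comp ((h1.div_const 2).neg.mul_const _))
    have h3 := h2.mul_const ⟪ξ, U x ξ⟫_ℂ
    simp only [zero_div, neg_zero, zero_mul, Real.exp_zero, Complex.ofReal_one, one_mul] at h3
    exact h3.congr fun n => (hν n x).symm
  have ht : IsTightMeasureSet (Set.range fun n => (ν n : Measure E)) :=
    isTightMeasureSet_of_tendsto_charFun (U.continuous_inner_apply ξ).continuousAt hlim
  have hcomp : IsCompact (closure (Set.range ν)) := by
    refine isCompact_closure_of_isTightMeasureSet ?_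
    convert ht using 1
    ext m
    simp
  obtain ⟨ν', -, hν'⟩ := hcomp.ultrafilter_le_nhds ((hyperfilter ℕ).map ν)
    (le_trans (by simp) (monotone_principal subset_closure))
  refine ⟨ν', fun x => ?_⟩
  have h1 : Tendsto ν (hyperfilter ℕ) (𝓝 ν') := hν'
  rw [ProbabilityMeasure.tendsto_iff_forall_integral_rclike_tendsto ℂ] at h1
  have h2 := h1 (BoundedContinuousFunction.innerProbChar x)
  simp_rw [← charFun_eq_integral_innerProbChar] at h2
  exact tendsto_nhds_unique h2 ((hlim x).mono_left Nat.hyperfilter_le_atTop)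

/-- Bochner's theorem for the function `x ↦ ⟪ξ, U x ξ⟫`. -/
theorem exists_charFun_eq (U : IsometricRep E K) (ξ : K) :
    ∃ ν : Measure E, IsFiniteMeasure ν ∧ ∀ x, charFun ν x = ⟪ξ, U x ξ⟫_ℂ := by
  by_cases hξ : ξ = 0
  · exact ⟨0, inferInstance, fun x => by simp [hξ]⟩
  have hn : ‖ξ‖ ≠ 0 := norm_ne_zero_iff.2 hξ
  obtain ⟨ν, hν⟩ := U.exists_probabilityMeasure_charFun_eq (ξ := ((‖ξ‖⁻¹ : ℝ) : ℂ) • ξ) (by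
    rw [norm_smul, Complex.norm_real, Real.norm_of_nonneg (by positivity), inv_mul_cancel₀ hn])
  refine ⟨(‖ξ‖₊ ^ 2) • (ν : Measure E), inferInstance, fun x => ?_⟩
  have h := hν x
  rw [map_smul, inner_smul_left, inner_smul_right, Complex.conj_ofReal] at h
  rw [charFun_apply] at h ⊢
  rw [integral_smul_nnreal_measure, h, NNReal.smul_def, Complex.real_smul, ← mul_assoc,
    ← mul_assoc]
  norm_cast
  simp only [NNReal.coe_pow, coe_nnnorm]
  rw [show ‖ξ‖ ^ 2 * ‖ξ‖⁻¹ * ‖ξ‖⁻¹ = 1 by field_simp]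
  simp

end BochnerMeasure

end IsometricRep

/-! ### The spectral measure of a vector -/

namespace IsometricRep

section Product

variable {E K : Type*} [NormedAddCommGroup E] [InnerProductSpace ℝ E]
  [FiniteDimensional ℝ E] [MeasurableSpace E] [BorelSpace E] [NormedAddCommGroup K]
  [InnerProductSpace ℂ K] [CompleteSpace K]

/-- Bochner's theorem on `E × E`, which carries the sup norm and so has no inner product of its
own. -/
theorem exists_measure_prod (U : IsometricRep (E × E) K) (ξ : K) :
    ∃ ν : Measure (E × E), IsFiniteMeasure ν ∧ ∀ x : E × E, ⟪ξ, U x ξ⟫_ℂ =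
      ∫ a, Complex.exp ((⟪a.1, x.1⟫_ℝ + ⟪a.2, x.2⟫_ℝ : ℝ) * Complex.I) ∂ν := by
  let U' : IsometricRep (WithLp 2 (E × E)) K :=
    { toFun := fun x => U (WithLp.ofLp x)
      map_add := fun z w ξ => U.map_add _ _ ξ
      continuous_apply := fun ξ =>
        (U.continuous_apply ξ).comp (WithLp.prod_continuous_ofLp 2 E E) }
  borelize (WithLp 2 (E × E))
  obtain ⟨ν, hν, h⟩ := U'.exists_charFun_eq ξ
  have hm : Measurable (WithLp.ofLp : WithLp 2 (E × E) → E × E) :=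
    (WithLp.prod_continuous_ofLp 2 E E).measurable
  refine ⟨ν.map WithLp.ofLp, inferInstance, fun x => ?_⟩
  rw [integral_map hm.aemeasurable (Continuous.aestronglyMeasurable (by fun_prop))]
  have := h (WithLp.toLp 2 x)
  rw [charFun_apply] at this
  simp only [WithLp.prod_inner_apply] at this
  exact this.symm

/-- An integral of translates of `ξ` has the norm of the Fourier transform of the weight, taken in
`L²` of the spectral measure `ν` of `ξ`. -/
theorem norm_integral_smul_sq_eq (U : IsometricRep (E × E) K) (ξ : K) :
    ∃ ν : Measure (E × E), IsFiniteMeasure ν ∧ ν.real Set.univ = ‖ξ‖ ^ 2 ∧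
      ∀ h : E × E → ℂ, Integrable h →
      ‖∫ w, h w • U w ξ‖ ^ 2 =
        ∫ a, ‖∫ w, h w * Complex.exp ((⟪a.1, w.1⟫_ℝ + ⟪a.2, w.2⟫_ℝ : ℝ) * Complex.I)‖ ^ 2 ∂ν := by
  obtain ⟨ν, hν, hU⟩ := U.exists_measure_prod ξ
  refine ⟨ν, hν, ?_, fun h hh => ?_⟩
  · have h0 := hU 0
    apply Complex.ofReal_injective
    rw [U.zero_apply, inner_self_eq_norm_sq_to_K] at h0
    simpa using h0.symm
  apply Complex.ofReal_injective
  rw [U.norm_integral_smul_sq hh]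
  set e : E × E → E × E → ℂ := fun a w =>
    Complex.exp ((⟪a.1, w.1⟫_ℝ + ⟪a.2, w.2⟫_ℝ : ℝ) * Complex.I) with he
  have hec : Continuous fun p : (E × E) × (E × E) => e p.1 p.2 := by fun_prop
  have hen : ∀ a w, ‖e a w‖ = 1 := fun a w => Complex.norm_exp_ofReal_mul_I _
  have hsub : ∀ a u w, e a (w - u) = starRingEnd ℂ (e a u) * e a w := by
    intro a u w
    simp only [he]
    rw [← Complex.exp_conj, ← Complex.exp_add]
    congr 1
    simp only [map_mul, Complex.conj_ofReal, Complex.conj_I, Prod.fst_sub, Prod.snd_sub,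
      inner_sub_right]
    push_cast
    ring
  have hint : Integrable (fun p : ((E × E) × (E × E)) × (E × E) =>
      starRingEnd ℂ (h p.1.1) * h p.1.2 * e p.2 (p.1.2 - p.1.1)) ((volume.prod volume).prod ν) := by
    have h1 : Integrable (fun q : (E × E) × (E × E) => starRingEnd ℂ (h q.1) * h q.2)
        (volume.prod volume) := by
      have hc : Integrable (fun u => starRingEnd ℂ (h u)) :=
        (Complex.conjLIE.toContinuousLinearEquiv.toContinuousLinearMap).integrable_comp hh
      exact hc.mul_prod hh
    have h2 : Integrable (fun p : ((E × E) × (E × E)) × (E × E) =>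
        starRingEnd ℂ (h p.1.1) * h p.1.2) ((volume.prod volume).prod ν) := by
      simpa using h1.mul_prod (integrable_const (μ := ν) (1 : ℂ))
    refine h2.mul_bdd (c := 1) ?_ (ae_of_all _ fun p => (hen _ _).le)
    exact Continuous.aestronglyMeasurable
      (hec.comp (f := fun p : ((E × E) × (E × E)) × (E × E) => (p.2, p.1.2 - p.1.1))
        (by fun_prop))
  have hint' : Integrable (fun q : (E × E) × (E × E) =>
      starRingEnd ℂ (h q.1) * h q.2 * ⟪ξ, U (q.2 - q.1) ξ⟫_ℂ) (volume.prod volume) := by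
    refine hint.integral_prod_left.congr (ae_of_all _ fun q => ?_)
    simp only
    rw [integral_const_mul, hU]
  calc ∫ u, ∫ w, starRingEnd ℂ (h u) * h w * ⟪ξ, U (w - u) ξ⟫_ℂ
      = ∫ q : (E × E) × (E × E), starRingEnd ℂ (h q.1) * h q.2 * ⟪ξ, U (q.2 - q.1) ξ⟫_ℂ
          ∂(volume.prod volume) := (integral_prod _ hint').symm
    _ = ∫ q : (E × E) × (E × E), ∫ a, starRingEnd ℂ (h q.1) * h q.2 * e a (q.2 - q.1) ∂ν
          ∂(volume.prod volume) := by
        congr with q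
        rw [integral_const_mul, hU]
    _ = ∫ a, ∫ q : (E × E) × (E × E), starRingEnd ℂ (h q.1) * h q.2 * e a (q.2 - q.1)
          ∂(volume.prod volume) ∂ν := integral_integral_swap hint
    _ = ∫ a, ((‖∫ w, h w * e a w‖ ^ 2 : ℝ) : ℂ) ∂ν := by
        congr with a
        rw [← Complex.normSq_eq_norm_sq, Complex.normSq_eq_conj_mul_self, ← integral_conj,
          ← integral_prod_mul]
        congr with q
        rw [hsub, map_mul]
        ring
    _ = _ := integral_complex_ofReal

end Product

end IsometricRep

/-! ### The Fourier multiplier of a regularized oscillatory integral -/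

section Partial

variable {E : Type*} [NormedAddCommGroup E] [InnerProductSpace ℝ E]

theorem exists_norm_iteratedFDeriv_partial_le (χ : 𝓢(E × E, ℂ)) (k j : ℕ) :
    ∃ C, ∀ x y : E, ‖iteratedFDeriv ℝ j (fun y => χ (x, y)) y‖ ≤ C * (1 + ‖y‖) ^ (-(k : ℝ)) := by
  refine ⟨2 ^ k * ((Finset.Iic (k, j)).sup fun m => SchwartzMap.seminorm ℝ m.1 m.2) χ,
    fun x y => ?_⟩
  have h1 := SchwartzMap.one_add_le_sup_seminorm_apply (𝕜 := ℝ) (m := (k, j)) le_rfl le_rfl χ (x, y)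
  have h2 : ‖iteratedFDeriv ℝ j (fun y => χ (x, y)) y‖ ≤ ‖iteratedFDeriv ℝ j χ (x, y)‖ := by
    have e1 : (fun y => χ (x, y)) =
        (fun p => χ ((x, 0) + p)) ∘ (ContinuousLinearMap.inr ℝ E E) := by
      funext y; simp
    have hs : ContDiff ℝ j (fun p : E × E => χ ((x, 0) + p)) :=
      (χ.smooth j).comp (contDiff_const.add contDiff_id)
    rw [e1, ContinuousLinearMap.iteratedFDeriv_comp_right _ hs _ le_rfl,
      iteratedFDeriv_comp_add_left]
    refine (ContinuousMultilinearMap.norm_compContinuousLinearMap_le _ _).trans ?_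
    simp only [ContinuousLinearMap.inr_apply, Prod.mk_add_mk, add_zero, zero_add]
    refine mul_le_of_le_one_right (norm_nonneg _) ?_
    exact Finset.prod_le_one (fun _ _ => norm_nonneg _)
      fun _ _ => ContinuousLinearMap.norm_inr_le_one ℝ E E
  rw [Real.rpow_neg (by positivity), Real.rpow_natCast, ← div_eq_mul_inv,
    le_div_iff₀ (by positivity), mul_comm]
  refine le_trans ?_ h1
  have h3 : ‖y‖ ≤ ‖(x, y)‖ := le_max_right _ _
  simp only
  gcongr

theorem contDiff_partial (χ : 𝓢(E × E, ℂ)) (x : E) (n : ℕ∞) :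
    ContDiff ℝ n fun y => χ (x, y) :=
  (χ.smooth n).comp (contDiff_const.prodMk contDiff_id)

end Partial

section Multiplier

variable {E : Type*} [NormedAddCommGroup E] [InnerProductSpace ℝ E]
  [FiniteDimensional ℝ E] [MeasurableSpace E] [BorelSpace E]

open FourierTransform

theorem exists_integrable_partial_bound (χ : 𝓢(E × E, ℂ)) (j : ℕ) :
    ∃ g : E → ℝ, Integrable g ∧
      ∀ x y : E, ‖iteratedFDeriv ℝ j (fun y => χ (x, y)) y‖ ≤ g y := by
  obtain ⟨C, hC⟩ := exists_norm_iteratedFDeriv_partial_le χ (Module.finrank ℝ E + 1) j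
  exact ⟨_, (integrable_one_add_norm (by push_cast; linarith)).const_mul C, hC⟩

theorem integrable_iteratedFDeriv_partial (χ : 𝓢(E × E, ℂ)) (j : ℕ) (x : E) :
    Integrable fun y => ‖iteratedFDeriv ℝ j (fun y => χ (x, y)) y‖ := by
  obtain ⟨g, hg, h⟩ := exists_integrable_partial_bound χ j
  refine hg.mono' ?_ (ae_of_all _ fun y => by simpa using h x y)
  exact ((contDiff_partial χ x j).continuous_iteratedFDeriv le_rfl).norm.aestronglyMeasurable

theorem integrable_partial (χ : 𝓢(E × E, ℂ)) (x : E) : Integrable fun y => χ (x, y) := by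
  have h := integrable_iteratedFDeriv_partial χ 0 x
  simp only [norm_iteratedFDeriv_zero] at h
  exact (integrable_norm_iff
    (contDiff_partial χ x 0).continuous.aestronglyMeasurable).1 h

/-- The partial Fourier transforms of a Schwartz function decay uniformly in the other variable. -/
theorem exists_norm_fourier_partial_le (χ : 𝓢(E × E, ℂ)) (n : ℕ) :
    ∃ C, ∀ x s : E, ‖s‖ ^ n * ‖𝓕 (fun y => χ (x, y)) s‖ ≤ C := by
  choose g hg h using fun j => exists_integrable_partial_bound χ j
  refine ⟨(2 * Real.pi) ^ 0 * (2 * (0 : ℕ) + 2) ^ n *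
    ∑ p ∈ Finset.range (0 + 1) ×ˢ Finset.range (n + 1), ∫ v, g p.2 v, fun x s => ?_⟩
  have h1 := Real.pow_mul_norm_iteratedFDeriv_fourier_le (K := 0) (N := n)
    (f := fun y => χ (x, y)) (contDiff_partial χ x n) (fun k m hk hm => by
      have : k = 0 := by simpa using hk
      subst this
      simpa using integrable_iteratedFDeriv_partial χ m x) (k := 0) (n := n) le_rfl le_rfl s
  rw [norm_iteratedFDeriv_zero] at h1
  refine h1.trans ?_
  gcongr with p hp
  · have : p.1 = 0 := by simpa using (Finset.mem_product.1 hp).1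
    simp only [this, pow_zero, one_mul]
    exact integrable_iteratedFDeriv_partial χ p.2 x
  · exact hg p.2
  · intro y
    have : p.1 = 0 := by simpa using (Finset.mem_product.1 hp).1
    simp only [this, pow_zero, one_mul]
    exact h p.2 x y

theorem exists_integrable_fourier_partial_bound (χ : 𝓢(E × E, ℂ)) :
    ∃ g : E → ℝ, Integrable g ∧ ∀ x s : E, ‖𝓕 (fun y => χ (x, y)) s‖ ≤ g s := by
  obtain ⟨C₀, h0⟩ := exists_norm_fourier_partial_le χ 0
  set N := Module.finrank ℝ E + 1 with hN
  obtain ⟨C₁, h1⟩ := exists_norm_fourier_partial_le χ N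
  refine ⟨_, (integrable_one_add_norm (r := (N : ℝ)) (by rw [hN]; push_cast; linarith)).const_mul
    (2 ^ (N - 1) * (C₀ + C₁)), fun x s => ?_⟩
  rw [Real.rpow_neg (by positivity), Real.rpow_natCast, ← div_eq_mul_inv,
    le_div_iff₀ (by positivity), mul_comm]
  have h2 := h0 x s
  rw [pow_zero, one_mul] at h2
  calc (1 + ‖s‖) ^ N * ‖𝓕 (fun y => χ (x, y)) s‖
      ≤ (2 ^ (N - 1) * (1 ^ N + ‖s‖ ^ N)) * ‖𝓕 (fun y => χ (x, y)) s‖ := by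
        gcongr
        exact add_pow_le (by norm_num) (norm_nonneg _) N
    _ = 2 ^ (N - 1) * (‖𝓕 (fun y => χ (x, y)) s‖ + ‖s‖ ^ N * ‖𝓕 (fun y => χ (x, y)) s‖) := by ring
    _ ≤ _ := by
        gcongr
        exact h1 x s

theorem continuous_fourier_partial (χ : 𝓢(E × E, ℂ)) :
    Continuous fun p : E × E => 𝓕 (fun y => χ (p.1, y)) p.2 := by
  obtain ⟨g, hg, h⟩ := exists_integrable_partial_bound χ 0
  simp only [norm_iteratedFDeriv_zero] at h
  simp only [Real.fourier_eq]
  have hχ : Continuous χ := χ.continuous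
  refine continuous_of_dominated (bound := g) (fun p => ?_) (fun p => ae_of_all _ fun y => ?_) hg
    (ae_of_all _ fun y => ?_)
  · exact Continuous.aestronglyMeasurable (by fun_prop)
  · rw [Circle.norm_smul]
    exact h _ _
  · fun_prop

/-- The Fourier transform, at `a`, of the weight of the regularized oscillatory integral. -/
def oscMultiplier (χ : 𝓢(E × E, ℂ)) (ε : ℝ) (a : E × E) : ℂ :=
  ∫ w : E × E, (χ (ε • w) * Complex.exp (-Complex.I * (⟪w.1, w.2⟫_ℝ : ℝ))) *
    Complex.exp ((⟪a.1, w.1⟫_ℝ + ⟪a.2, w.2⟫_ℝ : ℝ) * Complex.I)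

theorem integrable_oscWeight (χ : 𝓢(E × E, ℂ)) {ε : ℝ} (hε : 0 < ε) :
    Integrable fun w : E × E => χ (ε • w) * Complex.exp (-Complex.I * (⟪w.1, w.2⟫_ℝ : ℝ)) := by
  have : (volume : Measure (E × E)).IsAddHaarMeasure := by
    rw [Measure.volume_eq_prod]; infer_instance
  have h1 : Integrable fun w : E × E => χ (ε • w) :=
    (χ.integrable (μ := (volume : Measure (E × E)))).comp_smul hε.ne'
  refine h1.mul_bdd (c := 1) (by fun_prop) (ae_of_all _ fun w => ?_)
  rw [show -Complex.I * (⟪w.1, w.2⟫_ℝ : ℝ) = ((-⟪w.1, w.2⟫_ℝ : ℝ) : ℂ) * Complex.I by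
    push_cast; ring, Complex.norm_exp_ofReal_mul_I]

/-- The multiplier as a single integral in which `ε` may tend to `0`: integrate over the second
variable, and substitute `w.1 = a.2 + 2 π ε s`. -/
theorem oscMultiplier_eq (χ : 𝓢(E × E, ℂ)) {ε : ℝ} (hε : 0 < ε) (a : E × E) :
    oscMultiplier χ ε a = (((2 * Real.pi) ^ Module.finrank ℝ E : ℝ) : ℂ) *
      ∫ s : E, 𝓕 (fun y => χ (ε • (a.2 + (2 * Real.pi * ε) • s), y)) s *
        Complex.exp ((⟪a.1, a.2 + (2 * Real.pi * ε) • s⟫_ℝ : ℝ) * Complex.I) := by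
  have hint : Integrable (fun w : E × E =>
      (χ (ε • w) * Complex.exp (-Complex.I * (⟪w.1, w.2⟫_ℝ : ℝ))) *
      Complex.exp ((⟪a.1, w.1⟫_ℝ + ⟪a.2, w.2⟫_ℝ : ℝ) * Complex.I)) (volume.prod volume) :=
    (integrable_oscWeight χ hε).mul_bdd (c := 1) (by fun_prop)
      (ae_of_all _ fun w => (Complex.norm_exp_ofReal_mul_I _).le)
  have h2π : (0 : ℝ) < 2 * Real.pi := by positivity
  -- the integral over the second variable is a partial Fourier transform of `χ`
  have hin : ∀ u : E, ∫ v : E, (χ (ε • (u, v)) * Complex.exp (-Complex.I * (⟪u, v⟫_ℝ : ℝ))) *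
      Complex.exp ((⟪a.1, u⟫_ℝ + ⟪a.2, v⟫_ℝ : ℝ) * Complex.I) =
      (((ε ^ Module.finrank ℝ E)⁻¹ : ℝ) : ℂ) *
        (𝓕 (fun y => χ (ε • u, y)) ((2 * Real.pi * ε)⁻¹ • (u - a.2)) *
        Complex.exp ((⟪a.1, u⟫_ℝ : ℝ) * Complex.I)) := by
    intro u
    let f : E → ℂ := fun y =>
      (Complex.exp ((-2 * Real.pi * ⟪y, (2 * Real.pi * ε)⁻¹ • (u - a.2)⟫_ℝ : ℝ) *
          Complex.I) • χ (ε • u, y)) * Complex.exp ((⟪a.1, u⟫_ℝ : ℝ) * Complex.I)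
    have h1 : ∀ v : E, (χ (ε • (u, v)) * Complex.exp (-Complex.I * (⟪u, v⟫_ℝ : ℝ))) *
        Complex.exp ((⟪a.1, u⟫_ℝ + ⟪a.2, v⟫_ℝ : ℝ) * Complex.I) =
        f (ε • v) := by
      intro v
      simp only [f, Prod.smul_mk, smul_eq_mul]
      rw [mul_assoc, ← Complex.exp_add, mul_comm (Complex.exp _) (χ _), mul_assoc,
        ← Complex.exp_add]
      congr 2
      rw [real_inner_smul_left, real_inner_smul_right, real_inner_comm (u - a.2) v, inner_sub_left]
      have : -2 * Real.pi * (ε * ((2 * Real.pi * ε)⁻¹ * (⟪u, v⟫_ℝ - ⟪a.2, v⟫_ℝ))) =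
          ⟪a.2, v⟫_ℝ - ⟪u, v⟫_ℝ := by
        field_simp
        ring
      rw [this]
      push_cast
      ring
    simp_rw [h1]
    rw [Measure.integral_comp_smul volume f]
    simp only [f]
    rw [integral_mul_const, ← Real.fourier_eq', abs_of_pos (by positivity),
      Complex.real_smul]
  rw [oscMultiplier, Measure.volume_eq_prod, integral_prod _ hint]
  simp_rw [hin]
  rw [integral_const_mul]
  have h3 := integral_add_left_eq_self (μ := (volume : Measure E)) (fun u : E =>
    𝓕 (fun y => χ (ε • u, y)) ((2 * Real.pi * ε)⁻¹ • (u - a.2)) *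
        Complex.exp ((⟪a.1, u⟫_ℝ : ℝ) * Complex.I)) a.2
  rw [← h3]
  have h4 := Measure.integral_comp_smul (volume : Measure E) (fun u : E =>
    𝓕 (fun y => χ (ε • (a.2 + u), y)) ((2 * Real.pi * ε)⁻¹ • (a.2 + u - a.2)) *
        Complex.exp ((⟪a.1, a.2 + u⟫_ℝ : ℝ) * Complex.I)) (2 * Real.pi * ε)
  have h5 : ∀ s : E, (2 * Real.pi * ε)⁻¹ • (a.2 + (2 * Real.pi * ε) • s - a.2) = s := by
    intro s
    rw [add_sub_cancel_left, smul_smul, inv_mul_cancel₀ (by positivity), one_smul]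
  simp only [h5] at h4
  rw [h4, abs_of_pos (by positivity), Complex.real_smul, ← mul_assoc]
  congr 1
  norm_cast
  simp only [mul_pow]
  field_simp

/-- The multipliers are bounded uniformly in `ε`, although the weights have `L¹`-norms of the order
`ε ^ (-2 l)`. -/
theorem exists_norm_oscMultiplier_le (χ : 𝓢(E × E, ℂ)) :
    ∃ C, ∀ ε > 0, ∀ a : E × E, ‖oscMultiplier χ ε a‖ ≤ C := by
  obtain ⟨g, hg, h⟩ := exists_integrable_fourier_partial_bound χ
  refine ⟨(2 * Real.pi) ^ Module.finrank ℝ E * ∫ s, g s, fun ε hε a => ?_⟩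
  rw [oscMultiplier_eq χ hε, norm_mul, Complex.norm_real, Real.norm_of_nonneg (by positivity)]
  gcongr
  refine norm_integral_le_of_norm_le hg (ae_of_all _ fun s => ?_)
  rw [norm_mul, Complex.norm_exp_ofReal_mul_I, mul_one]
  exact h _ _

theorem tendsto_oscMultiplier (χ : 𝓢(E × E, ℂ)) (hχ : χ 0 = 1) (a : E × E) :
    Tendsto (fun ε => oscMultiplier χ ε a) (𝓝[>] 0)
      (𝓝 ((((2 * Real.pi) ^ Module.finrank ℝ E : ℝ) : ℂ) *
        Complex.exp ((⟪a.1, a.2⟫_ℝ : ℝ) * Complex.I))) := by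
  obtain ⟨g, hg, h⟩ := exists_integrable_fourier_partial_bound χ
  have hF := continuous_fourier_partial χ
  -- Fourier inversion at `0`, for `χ (0, ·)`
  have hinv : ∫ s : E, 𝓕 (fun y => χ (0, y)) s = 1 := by
    have hi : Integrable (𝓕 (fun y => χ ((0 : E), y))) := by
      refine hg.mono' ?_ (ae_of_all _ fun s => h 0 s)
      exact (hF.comp (Continuous.prodMk_right (0 : E))).aestronglyMeasurable
    have h1 := (integrable_partial χ 0).fourierInv_fourier_eq hi (v := 0)
      (contDiff_partial χ 0 0).continuous.continuousAt
    rw [Real.fourierInv_eq] at h1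
    simp only [inner_zero_right, AddChar.map_zero_eq_one, one_smul] at h1
    rw [h1, ← hχ]
    rfl
  have h2 : Tendsto (fun ε : ℝ => ∫ s : E,
      𝓕 (fun y => χ (ε • (a.2 + (2 * Real.pi * ε) • s), y)) s *
        Complex.exp ((⟪a.1, a.2 + (2 * Real.pi * ε) • s⟫_ℝ : ℝ) * Complex.I)) (𝓝[>] 0)
      (𝓝 (∫ s : E, 𝓕 (fun y => χ ((0 : ℝ) • (a.2 + (2 * Real.pi * (0 : ℝ)) • s), y)) s *
        Complex.exp ((⟪a.1, a.2 + (2 * Real.pi * (0 : ℝ)) • s⟫_ℝ : ℝ) * Complex.I))) := by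
    have hc : Continuous fun q : ℝ × E =>
        𝓕 (fun y => χ (q.1 • (a.2 + (2 * Real.pi * q.1) • q.2), y)) q.2 *
        Complex.exp ((⟪a.1, a.2 + (2 * Real.pi * q.1) • q.2⟫_ℝ : ℝ) * Complex.I) := by
      refine Continuous.mul ?_ (by fun_prop)
      exact hF.comp (f := fun q : ℝ × E => (q.1 • (a.2 + (2 * Real.pi * q.1) • q.2), q.2))
        (by fun_prop)
    refine tendsto_integral_filter_of_dominated_convergence g ?_ ?_ hg ?_
    · exact .of_forall fun ε => (hc.comp (Continuous.prodMk_right ε)).aestronglyMeasurable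
    · refine .of_forall fun ε => ae_of_all _ fun s => ?_
      rw [norm_mul, Complex.norm_exp_ofReal_mul_I, mul_one]
      exact h _ _
    · refine ae_of_all _ fun s => ?_
      exact ((hc.comp (Continuous.prodMk_left s)).tendsto 0).mono_left nhdsWithin_le_nhds
  simp only [zero_smul, mul_zero, add_zero] at h2
  rw [integral_mul_const, hinv, one_mul] at h2
  refine (h2.const_mul _).congr' ?_
  filter_upwards [self_mem_nhdsWithin] with ε hε
  exact (oscMultiplier_eq χ hε a).symm

end Multiplier

/-! ### Oscillatory integrals of isometric representations -/

section Multiplier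

variable {E : Type*} [NormedAddCommGroup E] [InnerProductSpace ℝ E]
  [FiniteDimensional ℝ E] [MeasurableSpace E] [BorelSpace E]

theorem continuous_oscMultiplier (χ : 𝓢(E × E, ℂ)) {ε : ℝ} (hε : 0 < ε) :
    Continuous (oscMultiplier χ ε) := by
  have hi := integrable_oscWeight χ hε
  refine continuous_of_dominated (fun a => ?_) (fun a => ae_of_all _ fun w => ?_) hi.norm
    (ae_of_all _ fun w => by fun_prop)
  · exact hi.aestronglyMeasurable.mul (Continuous.aestronglyMeasurable (by fun_prop))
  · rw [norm_mul, Complex.norm_exp_ofReal_mul_I, mul_one]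

end Multiplier

/-- A Schwartz function with the value `1` at the origin. -/
theorem exists_schwartz_one (l : ℕ) :
    ∃ χ₀ : 𝓢(EuclideanSpace ℝ (Fin l) × EuclideanSpace ℝ (Fin l), ℂ), χ₀ 0 = 1 := by
  let b : ContDiffBump (0 : EuclideanSpace ℝ (Fin l) × EuclideanSpace ℝ (Fin l)) :=
    ⟨1, 2, by norm_num, by norm_num⟩
  have hb : HasCompactSupport fun x => (b x : ℂ) :=
    b.hasCompactSupport.comp_left (g := fun r : ℝ => (r : ℂ)) (by simp)
  have hd : ContDiff ℝ ∞ fun x => (b x : ℂ) := Complex.ofRealCLM.contDiff.comp b.contDiff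
  refine ⟨hb.toSchwartzMap hd, ?_⟩
  have h1 : b 0 = 1 := b.one_of_mem_closedBall (Metric.mem_closedBall_self zero_le_one)
  change ((b 0 : ℝ) : ℂ) = 1
  rw [h1, Complex.ofReal_one]

namespace IsometricRep

variable {l : ℕ} {K : Type*} [NormedAddCommGroup K] [InnerProductSpace ℂ K] [CompleteSpace K]

local notation "𝔼" => EuclideanSpace ℝ (Fin l)

/-- The absolutely convergent integral that regularizes `(2π)⁻ˡ ∫∫ e^{-i⟪y, z⟫} U(y, z) ξ dy dz`. -/
def regularized (U : IsometricRep (𝔼 × 𝔼) K) (χ : 𝓢(𝔼 × 𝔼, ℂ)) (ε : ℝ) (ξ : K) : K :=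
  (((2 * Real.pi) ^ l)⁻¹ : ℝ) • ∫ w : 𝔼 × 𝔼,
    (χ (ε • w) * Complex.exp (-Complex.I * (⟪w.1, w.2⟫_ℝ : ℝ))) • U w ξ

theorem integrable_regularized (U : IsometricRep (𝔼 × 𝔼) K) (χ : 𝓢(𝔼 × 𝔼, ℂ)) {ε : ℝ}
    (hε : 0 < ε) (ξ : K) : Integrable fun w : 𝔼 × 𝔼 =>
      (χ (ε • w) * Complex.exp (-Complex.I * (⟪w.1, w.2⟫_ℝ : ℝ))) • U w ξ :=
  U.integrable_smul (integrable_oscWeight χ hε) ξ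

theorem regularized_add (U : IsometricRep (𝔼 × 𝔼) K) (χ : 𝓢(𝔼 × 𝔼, ℂ)) {ε : ℝ}
    (hε : 0 < ε) (ξ η : K) :
    U.regularized χ ε (ξ + η) = U.regularized χ ε ξ + U.regularized χ ε η := by
  simp only [regularized, _root_.map_add, smul_add]
  rw [integral_add (U.integrable_regularized χ hε ξ) (U.integrable_regularized χ hε η), smul_add]

theorem regularized_smul (U : IsometricRep (𝔼 × 𝔼) K) (χ : 𝓢(𝔼 × 𝔼, ℂ)) (ε : ℝ) (c : ℂ)
    (ξ : K) : U.regularized χ ε (c • ξ) = c • U.regularized χ ε ξ := by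
  have h : ∀ w : 𝔼 × 𝔼, (χ (ε • w) * Complex.exp (-Complex.I * (⟪w.1, w.2⟫_ℝ : ℝ))) • U w (c • ξ) =
      c • (χ (ε • w) * Complex.exp (-Complex.I * (⟪w.1, w.2⟫_ℝ : ℝ))) • U w ξ := fun w => by
    rw [(U w).map_smul, smul_comm]
  simp only [regularized, h]
  rw [integral_smul, smul_comm]

/-- The spectral measure of `ξ` turns regularized integrals of `ξ` into multipliers, with their
`L²`-norms and distances. -/
theorem exists_spectral (U : IsometricRep (𝔼 × 𝔼) K) (ξ : K) :
    ∃ ν : Measure (𝔼 × 𝔼), IsFiniteMeasure ν ∧ ν.real Set.univ = ‖ξ‖ ^ 2 ∧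
      (∀ χ : 𝓢(𝔼 × 𝔼, ℂ), ∀ ε > 0, ‖U.regularized χ ε ξ‖ ^ 2 =
        ∫ a, ‖((((2 * Real.pi) ^ l)⁻¹ : ℝ) : ℂ) * oscMultiplier χ ε a‖ ^ 2 ∂ν) ∧
      ∀ χ χ' : 𝓢(𝔼 × 𝔼, ℂ), ∀ ε > 0, ∀ ε' > 0,
        ‖U.regularized χ ε ξ - U.regularized χ' ε' ξ‖ ^ 2 =
        ∫ a, ‖((((2 * Real.pi) ^ l)⁻¹ : ℝ) : ℂ) * oscMultiplier χ ε a -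
          ((((2 * Real.pi) ^ l)⁻¹ : ℝ) : ℂ) * oscMultiplier χ' ε' a‖ ^ 2 ∂ν := by
  obtain ⟨ν, hν, hν1, h⟩ := U.norm_integral_smul_sq_eq ξ
  refine ⟨ν, hν, hν1, fun χ ε hε => ?_, fun χ χ' ε hε ε' hε' => ?_⟩
  · rw [regularized, norm_smul, mul_pow, h _ (integrable_oscWeight χ hε), ← integral_const_mul]
    congr with a
    rw [norm_mul, Complex.norm_real, mul_pow ‖((2 * Real.pi) ^ l)⁻¹‖]
    rfl
  · have hi := integrable_oscWeight χ hε
    have hi' := integrable_oscWeight χ' hε'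
    have hb : ∀ a : 𝔼 × 𝔼, ∀ g : 𝔼 × 𝔼 → ℂ, Integrable g → Integrable fun w => g w *
        Complex.exp ((⟪a.1, w.1⟫_ℝ + ⟪a.2, w.2⟫_ℝ : ℝ) * Complex.I) := fun a g hg =>
      hg.mul_bdd (c := 1) (by fun_prop) (ae_of_all _ fun w => (Complex.norm_exp_ofReal_mul_I _).le)
    rw [regularized, regularized, ← smul_sub,
      ← integral_sub (U.integrable_regularized χ hε ξ) (U.integrable_regularized χ' hε' ξ)]
    simp_rw [← sub_smul]
    have h1 := h (fun w => χ (ε • w) * Complex.exp (-Complex.I * (⟪w.1, w.2⟫_ℝ : ℝ)) -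
      χ' (ε' • w) * Complex.exp (-Complex.I * (⟪w.1, w.2⟫_ℝ : ℝ))) (hi.sub hi')
    rw [norm_smul, mul_pow, h1, ← integral_const_mul]
    congr with a
    rw [← mul_sub, norm_mul, Complex.norm_real, mul_pow ‖((2 * Real.pi) ^ l)⁻¹‖]
    congr 3
    simp only [sub_mul]
    rw [integral_sub (hb a _ hi) (hb a _ hi')]
    rfl

theorem tendsto_const_mul_oscMultiplier (χ : 𝓢(𝔼 × 𝔼, ℂ)) (hχ : χ 0 = 1) (a : 𝔼 × 𝔼) :
    Tendsto (fun ε => ((((2 * Real.pi) ^ l)⁻¹ : ℝ) : ℂ) * oscMultiplier χ ε a) (𝓝[>] 0)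
      (𝓝 (Complex.exp ((⟪a.1, a.2⟫_ℝ : ℝ) * Complex.I))) := by
  have h := (tendsto_oscMultiplier χ hχ a).const_mul ((((2 * Real.pi) ^ l)⁻¹ : ℝ) : ℂ)
  rw [← mul_assoc, ← Complex.ofReal_mul, finrank_euclideanSpace_fin,
    inv_mul_cancel₀ (by positivity), Complex.ofReal_one, one_mul] at h
  exact h

/-- The norm is preserved in the limit, because the limit multiplier `e^{i⟪a, b⟫}` has modulus
one. -/
theorem tendsto_norm_regularized (U : IsometricRep (𝔼 × 𝔼) K) (χ : 𝓢(𝔼 × 𝔼, ℂ)) (hχ : χ 0 = 1)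
    (ξ : K) : Tendsto (fun ε => ‖U.regularized χ ε ξ‖ ^ 2) (𝓝[>] 0) (𝓝 (‖ξ‖ ^ 2)) := by
  obtain ⟨ν, hν, hν1, h, -⟩ := U.exists_spectral ξ
  obtain ⟨C, hC⟩ := exists_norm_oscMultiplier_le χ
  have h1 : Tendsto (fun ε => ∫ a, ‖((((2 * Real.pi) ^ l)⁻¹ : ℝ) : ℂ) *
      oscMultiplier χ ε a‖ ^ 2 ∂ν) (𝓝[>] 0)
      (𝓝 (∫ a : 𝔼 × 𝔼, ‖Complex.exp ((⟪a.1, a.2⟫_ℝ : ℝ) * Complex.I)‖ ^ 2 ∂ν)) := by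
    refine tendsto_integral_filter_of_dominated_convergence
      (fun _ => ((((2 * Real.pi) ^ l)⁻¹ : ℝ) * C) ^ 2) ?_ ?_ (integrable_const _) ?_
    · filter_upwards [self_mem_nhdsWithin] with ε hε
      have := continuous_oscMultiplier χ hε
      exact Continuous.aestronglyMeasurable (by fun_prop)
    · filter_upwards [self_mem_nhdsWithin] with ε hε
      refine ae_of_all _ fun a => ?_
      rw [norm_pow, norm_norm, norm_mul, Complex.norm_real, Real.norm_of_nonneg (by positivity)]
      gcongr
      exact hC ε hε a
    · exact ae_of_all _ fun a => (tendsto_const_mul_oscMultiplier χ hχ a).norm.pow 2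
  simp only [Complex.norm_exp_ofReal_mul_I, one_pow, integral_const, hν1, smul_eq_mul,
    mul_one] at h1
  refine h1.congr' ?_
  filter_upwards [self_mem_nhdsWithin] with ε hε using (h χ ε hε).symm

/-- Regularized integrals, even those with different cut-off functions, approach each other. -/
theorem tendsto_regularized_sub (U : IsometricRep (𝔼 × 𝔼) K) (χ χ' : 𝓢(𝔼 × 𝔼, ℂ))
    (hχ : χ 0 = 1) (hχ' : χ' 0 = 1) (ξ : K) :
    Tendsto (fun p : ℝ × ℝ => U.regularized χ p.1 ξ - U.regularized χ' p.2 ξ)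
      (𝓝[>] 0 ×ˢ 𝓝[>] 0) (𝓝 0) := by
  obtain ⟨ν, hν, -, -, h⟩ := U.exists_spectral ξ
  obtain ⟨C, hC⟩ := exists_norm_oscMultiplier_le χ
  obtain ⟨C', hC'⟩ := exists_norm_oscMultiplier_le χ'
  have hmem : ∀ᶠ p : ℝ × ℝ in 𝓝[>] 0 ×ˢ 𝓝[>] 0, 0 < p.1 ∧ 0 < p.2 :=
    (eventually_mem_nhdsWithin).prod_mk (eventually_mem_nhdsWithin)
  have h1 : Tendsto (fun p : ℝ × ℝ => ∫ a, ‖((((2 * Real.pi) ^ l)⁻¹ : ℝ) : ℂ) *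
      oscMultiplier χ p.1 a - ((((2 * Real.pi) ^ l)⁻¹ : ℝ) : ℂ) * oscMultiplier χ' p.2 a‖ ^ 2 ∂ν)
      (𝓝[>] 0 ×ˢ 𝓝[>] 0) (𝓝 (∫ a : 𝔼 × 𝔼, ‖Complex.exp ((⟪a.1, a.2⟫_ℝ : ℝ) * Complex.I) -
        Complex.exp ((⟪a.1, a.2⟫_ℝ : ℝ) * Complex.I)‖ ^ 2 ∂ν)) := by
    refine tendsto_integral_filter_of_dominated_convergence
      (fun _ => ((((2 * Real.pi) ^ l)⁻¹ : ℝ) * C + (((2 * Real.pi) ^ l)⁻¹ : ℝ) * C') ^ 2) ?_ ?_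
      (integrable_const _) ?_
    · filter_upwards [hmem] with p hp
      have := continuous_oscMultiplier χ hp.1
      have := continuous_oscMultiplier χ' hp.2
      exact Continuous.aestronglyMeasurable (by fun_prop)
    · filter_upwards [hmem] with p hp
      refine ae_of_all _ fun a => ?_
      rw [norm_pow, norm_norm]
      refine pow_le_pow_left₀ (norm_nonneg _) ((norm_sub_le _ _).trans ?_) 2
      rw [norm_mul, norm_mul, Complex.norm_real, Real.norm_of_nonneg (by positivity)]
      gcongr
      · exact hC p.1 hp.1 a
      · exact hC' p.2 hp.2 a
    · refine ae_of_all _ fun a => ?_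
      exact (((tendsto_const_mul_oscMultiplier χ hχ a).comp tendsto_fst).sub
        ((tendsto_const_mul_oscMultiplier χ' hχ' a).comp tendsto_snd)).norm.pow 2
  simp only [sub_self, norm_zero, ne_eq, OfNat.ofNat_ne_zero, not_false_eq_true, zero_pow,
    integral_zero] at h1
  have h2 : Tendsto (fun p : ℝ × ℝ => ‖U.regularized χ p.1 ξ - U.regularized χ' p.2 ξ‖ ^ 2)
      (𝓝[>] 0 ×ˢ 𝓝[>] 0) (𝓝 0) := by
    refine h1.congr' ?_
    filter_upwards [hmem] with p hp using (h χ χ' p.1 hp.1 p.2 hp.2).symm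
  rw [tendsto_zero_iff_norm_tendsto_zero]
  have h3 := (Real.continuous_sqrt.tendsto _).comp h2
  simpa [Function.comp_def, Real.sqrt_sq (norm_nonneg _)] using h3

theorem tendsto_regularized_sub_self (U : IsometricRep (𝔼 × 𝔼) K) (χ χ' : 𝓢(𝔼 × 𝔼, ℂ))
    (hχ : χ 0 = 1) (hχ' : χ' 0 = 1) (ξ : K) :
    Tendsto (fun ε => U.regularized χ ε ξ - U.regularized χ' ε ξ) (𝓝[>] 0) (𝓝 0) := by
  have hp : Tendsto (fun ε : ℝ => (ε, ε)) (𝓝[>] 0) (𝓝[>] 0 ×ˢ 𝓝[>] 0) :=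
    tendsto_id.prodMk tendsto_id
  have h := Tendsto.comp (U.tendsto_regularized_sub χ χ' hχ hχ' ξ) hp
  simpa only [Function.comp_def] using h

theorem exists_hasOscIntegral (U : IsometricRep (𝔼 × 𝔼) K) (ξ : K) :
    ∃ v, HasOscIntegral (fun y z => U (y, z) ξ) v := by
  obtain ⟨χ₀, h₀⟩ := exists_schwartz_one l
  have hd : Tendsto (fun p : ℝ × ℝ => dist (U.regularized χ₀ p.1 ξ) (U.regularized χ₀ p.2 ξ))
      (𝓝[>] 0 ×ˢ 𝓝[>] 0) (𝓝 0) := by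
    simp_rw [dist_eq_norm]
    exact tendsto_zero_iff_norm_tendsto_zero.1 (U.tendsto_regularized_sub χ₀ χ₀ h₀ h₀ ξ)
  have hc : Cauchy (map (fun ε => U.regularized χ₀ ε ξ) (𝓝[>] 0)) :=
    cauchy_map_iff.2 ⟨inferInstance, tendsto_uniformity_iff_dist_tendsto_zero.2 hd⟩
  obtain ⟨v, hv⟩ := cauchy_map_iff_exists_tendsto.1 hc
  refine ⟨v, ?_⟩
  unfold HasOscIntegral
  intro χ hχ
  have h1 := (U.tendsto_regularized_sub_self χ χ₀ hχ h₀ ξ).add hv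
  rw [zero_add] at h1
  exact h1.congr fun ε => sub_add_cancel _ _

theorem hasOscIntegral_unique {l : ℕ} {K : Type*} [NormedAddCommGroup K] [InnerProductSpace ℂ K]
    {a : EuclideanSpace ℝ (Fin l) → EuclideanSpace ℝ (Fin l) → K} {v v' : K}
    (h : HasOscIntegral a v) (h' : HasOscIntegral a v') : v = v' := by
  obtain ⟨χ₀, h₀⟩ := exists_schwartz_one l
  exact tendsto_nhds_unique (h χ₀ h₀) (h' χ₀ h₀)

/-- The oscillatory integral `(2π)⁻ˡ ∫∫ e^{-i⟪y, z⟫} U(y, z) dy dz` converges strongly to an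
isometry. In a joint spectral representation of `U`, it is multiplication with `e^{i⟪a, b⟫}`. -/
theorem exists_linearIsometry_hasOscIntegral (U : IsometricRep (𝔼 × 𝔼) K) :
    ∃ T : K →ₗᵢ[ℂ] K, ∀ ξ, HasOscIntegral (fun y z => U (y, z) ξ) (T ξ) := by
  choose T hT using U.exists_hasOscIntegral
  obtain ⟨χ₀, h₀⟩ := exists_schwartz_one l
  have hT₀ : ∀ ξ, Tendsto (fun ε => U.regularized χ₀ ε ξ) (𝓝[>] 0) (𝓝 (T ξ)) :=
    fun ξ => hT ξ χ₀ h₀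
  refine ⟨⟨⟨⟨T, fun ξ η => ?_⟩, fun c ξ => ?_⟩, fun ξ => ?_⟩, hT⟩
  · refine tendsto_nhds_unique (hT₀ _) (((hT₀ ξ).add (hT₀ η)).congr' ?_)
    filter_upwards [self_mem_nhdsWithin] with ε hε using (U.regularized_add χ₀ hε ξ η).symm
  · refine tendsto_nhds_unique (hT₀ _) (((hT₀ ξ).const_smul c).congr' ?_)
    filter_upwards with ε using (U.regularized_smul χ₀ ε c ξ).symm
  · have h1 := tendsto_nhds_unique ((hT₀ ξ).norm.pow 2) (U.tendsto_norm_regularized χ₀ h₀ ξ)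
    exact (pow_left_inj₀ (norm_nonneg _) (norm_nonneg _) two_ne_zero).1 h1

end IsometricRep

/-! ### Hilbert–Schmidt operators and the conjugation representation -/

section HilbertSchmidt

variable {H : Type*} [NormedAddCommGroup H] [InnerProductSpace ℂ H] [CompleteSpace H]

theorem enorm_inner_le (x y : H) : ‖⟪x, y⟫_ℂ‖ₑ ≤ ‖x‖ₑ * ‖y‖ₑ := by
  rw [← ofReal_norm, ← ofReal_norm, ← ofReal_norm, ← ENNReal.ofReal_mul (norm_nonneg _)]
  exact ENNReal.ofReal_le_ofReal (norm_inner_le_norm x y)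

theorem hsNormSq_conj (S T : H ≃ₗᵢ[ℂ] H) (A : H →L[ℂ] H) :
    hsNormSq ((S : H →L[ℂ] H) ∘L A ∘L (T : H →L[ℂ] H)) = hsNormSq A := by
  obtain ⟨w, e, -⟩ := exists_hilbertBasis ℂ H
  rw [hsNormSq_eq_tsum e, hsNormSq_eq_tsum (HilbertBasis.ofRepr (T.symm.trans e.repr))]
  refine tsum_congr fun i => ?_
  have h1 : (HilbertBasis.ofRepr (T.symm.trans e.repr)) i = T (e i) := by
    classical
    rw [← HilbertBasis.repr_symm_single, ← HilbertBasis.repr_symm_single e]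
    rfl
  rw [h1]
  simp

theorem hsNormSq_adjoint (A : H →L[ℂ] H) :
    hsNormSq (ContinuousLinearMap.adjoint A) = hsNormSq A := by
  obtain ⟨w, e, -⟩ := exists_hilbertBasis ℂ H
  rw [hsNormSq_eq_tsum e A, hsNormSq_eq_tsum e, tsum_enorm_sq_eq_adjoint e e A]

theorem hsNormSq_add_le (A B : H →L[ℂ] H) :
    hsNormSq (A + B) ≤ 2 * (hsNormSq A + hsNormSq B) := by
  obtain ⟨w, e, -⟩ := exists_hilbertBasis ℂ H
  rw [hsNormSq_eq_tsum e, hsNormSq_eq_tsum e, hsNormSq_eq_tsum e, ← ENNReal.tsum_add,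
    ← ENNReal.tsum_mul_left]
  refine ENNReal.tsum_le_tsum fun i => ?_
  refine (pow_le_pow_left' (enorm_add_le (A (e i)) (B (e i))) 2).trans ?_
  have := ENNReal.rpow_add_le_mul_rpow_add_rpow ‖A (e i)‖ₑ ‖B (e i)‖ₑ (p := 2) one_le_two
  norm_num at this
  exact this

theorem enorm_apply_sq_le (A : H →L[ℂ] H) (x : H) :
    ‖A x‖ₑ ^ 2 ≤ hsNormSq A * ‖x‖ₑ ^ 2 := by
  obtain ⟨w, e, -⟩ := exists_hilbertBasis ℂ H
  rw [← tsum_enorm_inner_sq e (A x), ← hsNormSq_adjoint, hsNormSq_eq_tsum e,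
    ← ENNReal.tsum_mul_right]
  refine ENNReal.tsum_le_tsum fun i => ?_
  rw [← ContinuousLinearMap.adjoint_inner_left, ← mul_pow]
  gcongr
  exact enorm_inner_le _ _

theorem isHilbertSchmidt_iff {A : H →L[ℂ] H} : IsHilbertSchmidt A ↔ hsNormSq A < ⊤ := by
  rw [IsHilbertSchmidt, hsNorm, ENNReal.rpow_lt_top_iff_of_pos (by norm_num)]

variable {l : ℕ}

theorem UnitaryRep.zero_apply (V : UnitaryRep l H) (x : H) : V 0 x = x := by
  apply (V 0).injective
  rw [← V.map_add, add_zero]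

theorem UnitaryRep.adjoint_eq (V : UnitaryRep l H) (t : EuclideanSpace ℝ (Fin l)) :
    ContinuousLinearMap.adjoint (V t : H →L[ℂ] H) = (V (-t) : H →L[ℂ] H) := by
  refine (ContinuousLinearMap.eq_adjoint_iff _ _).2 (fun x y => ?_) |>.symm
  have h : ⟪V t (V (-t) x), V t y⟫_ℂ = ⟪V (-t) x, y⟫_ℂ := (V t).inner_map_map _ _
  rw [← V.map_add, add_neg_cancel, V.zero_apply] at h
  exact h.symm

/-- Left multiplication with `V s` is continuous in the Hilbert–Schmidt norm: this is dominated
convergence for the sum over an orthonormal basis. -/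
theorem UnitaryRep.tendsto_hsNormSq_left (V : UnitaryRep l H) {A : H →L[ℂ] H}
    (hA : hsNormSq A < ⊤) :
    Tendsto (fun s => hsNormSq ((V s : H →L[ℂ] H) ∘L A - A)) (𝓝 0) (𝓝 0) := by
  obtain ⟨w, e, -⟩ := exists_hilbertBasis ℂ H
  let _ : MeasurableSpace w := ⊤
  have hA' := hA
  rw [hsNormSq_eq_tsum e, ← lintegral_count] at hA'
  simp_rw [hsNormSq_eq_tsum e, ← lintegral_count]
  have h0 : (0 : ℝ≥0∞) = ∫⁻ _ : w, 0 ∂Measure.count := by simp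
  rw [h0]
  refine tendsto_lintegral_filter_of_dominated_convergence
    (fun i => 4 * ‖A (e i)‖ₑ ^ 2) (.of_forall fun s => measurable_from_top)
    (.of_forall fun s => ae_of_all _ fun i => ?_) ?_ (ae_of_all _ fun i => ?_)
  · have h1 : ‖V s (A (e i)) - A (e i)‖ₑ ≤ 2 * ‖A (e i)‖ₑ := by
      refine (enorm_sub_le).trans ?_
      rw [(V s).enorm_map, two_mul]
    calc ‖((V s : H →L[ℂ] H) ∘L A - A) (e i)‖ₑ ^ 2 ≤ (2 * ‖A (e i)‖ₑ) ^ 2 :=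
          pow_le_pow_left' h1 2
      _ = 4 * ‖A (e i)‖ₑ ^ 2 := by rw [mul_pow]; norm_num
  · rw [lintegral_const_mul' _ _ (by simp)]
    exact ENNReal.mul_ne_top (by simp) hA'.ne
  · have h1 : Tendsto (fun s => V s (A (e i)) - A (e i)) (𝓝 0) (𝓝 (V 0 (A (e i)) - A (e i))) :=
      ((V.continuous_apply (A (e i))).tendsto 0).sub tendsto_const_nhds
    rw [V.zero_apply, sub_self] at h1
    have h2 := ((ENNReal.continuous_pow 2).tendsto _).comp h1.enorm
    simpa [Function.comp_def] using h2

theorem UnitaryRep.tendsto_hsNormSq_right (V : UnitaryRep l H) {A : H →L[ℂ] H}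
    (hA : hsNormSq A < ⊤) :
    Tendsto (fun t => hsNormSq (A ∘L (V t : H →L[ℂ] H) - A)) (𝓝 0) (𝓝 0) := by
  have h1 := V.tendsto_hsNormSq_left (A := ContinuousLinearMap.adjoint A)
    (by rwa [hsNormSq_adjoint])
  have h2 : Tendsto (fun t : EuclideanSpace ℝ (Fin l) => -t) (𝓝 0) (𝓝 0) := by
    simpa using (continuous_neg (G := EuclideanSpace ℝ (Fin l))).tendsto 0
  refine (h1.comp h2).congr fun t => ?_
  rw [Function.comp_apply, ← hsNormSq_adjoint (A ∘L _ - A), map_sub,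
    ContinuousLinearMap.adjoint_comp, V.adjoint_eq]

theorem UnitaryRep.tendsto_hsNormSq_conj (V : UnitaryRep l H) {A : H →L[ℂ] H}
    (hA : hsNormSq A < ⊤) {X : Type*} {F : Filter X} {a b : X → EuclideanSpace ℝ (Fin l)}
    (ha : Tendsto a F (𝓝 0)) (hb : Tendsto b F (𝓝 0)) :
    Tendsto (fun x => hsNormSq ((V (a x) : H →L[ℂ] H) ∘L A ∘L (V (b x) : H →L[ℂ] H) - A))
      F (𝓝 0) := by
  have h1 := ENNReal.Tendsto.const_mul (a := 2) (((V.tendsto_hsNormSq_right hA).comp hb).add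
    ((V.tendsto_hsNormSq_left hA).comp ha)) (Or.inr (by simp))
  rw [add_zero, mul_zero] at h1
  refine tendsto_of_tendsto_of_tendsto_of_le_of_le tendsto_const_nhds h1 (fun _ => zero_le)
    fun x => ?_
  have h2 : (V (a x) : H →L[ℂ] H) ∘L A ∘L (V (b x) : H →L[ℂ] H) - A =
      (V (a x) : H →L[ℂ] H) ∘L (A ∘L (V (b x) : H →L[ℂ] H) - A) ∘L
        ((LinearIsometryEquiv.refl ℂ H : H ≃ₗᵢ[ℂ] H) : H →L[ℂ] H) +
      ((V (a x) : H →L[ℂ] H) ∘L A - A) := by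
    ext ψ
    simp
  simp only [Function.comp_apply]
  rw [h2]
  refine (hsNormSq_add_le _ _).trans ?_
  rw [hsNormSq_conj]

end HilbertSchmidt

section Model

variable {H : Type*} [NormedAddCommGroup H] [InnerProductSpace ℂ H] [CompleteSpace H]
  {𝒦 : Type*} [NormedAddCommGroup 𝒦] [InnerProductSpace ℂ 𝒦]

/-- A linear identification of the Hilbert space `𝒦` with the Hilbert–Schmidt operators on `H`. -/
structure HSModel (𝒦 H : Type*) [NormedAddCommGroup H] [InnerProductSpace ℂ H]
    [NormedAddCommGroup 𝒦] [InnerProductSpace ℂ 𝒦] where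
  /-- the operator that corresponds to a vector -/
  toOp : 𝒦 →ₗ[ℂ] (H →L[ℂ] H)
  hsNormSq_toOp : ∀ k, hsNormSq (toOp k) = ‖k‖ₑ ^ 2
  surj : ∀ A : H →L[ℂ] H, hsNormSq A < ⊤ → ∃ k, toOp k = A

namespace HSModel

theorem injective (J : HSModel 𝒦 H) : Function.Injective J.toOp := by
  rw [injective_iff_map_eq_zero]
  intro k hk
  have h1 := J.hsNormSq_toOp k
  obtain ⟨w, e, -⟩ := exists_hilbertBasis ℂ H
  rw [hk, hsNormSq_eq_tsum e] at h1
  simpa using h1.symm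

/-- Evaluation of operators at `x`. -/
def eval (J : HSModel 𝒦 H) (x : H) : 𝒦 →L[ℂ] H :=
  LinearMap.mkContinuous
    { toFun := fun k => J.toOp k x
      map_add' := fun k k' => by simp
      map_smul' := fun c k => by simp } ‖x‖ fun k => by
    have h1 := enorm_apply_sq_le (J.toOp k) x
    rw [J.hsNormSq_toOp, ← mul_pow] at h1
    have h2 : ‖J.toOp k x‖ₑ ≤ ‖k‖ₑ * ‖x‖ₑ := (ENNReal.pow_le_pow_left_iff two_ne_zero).1 h1
    rw [← ofReal_norm, ← ofReal_norm, ← ofReal_norm, ← ENNReal.ofReal_mul (norm_nonneg _),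
      ENNReal.ofReal_le_ofReal_iff (by positivity)] at h2
    simpa [mul_comm] using h2

theorem eval_apply (J : HSModel 𝒦 H) (x : H) (k : 𝒦) : J.eval x k = J.toOp k x := rfl

/-- The map `A ↦ S A T`, on the Hilbert space that models the Hilbert–Schmidt operators. -/
theorem exists_conj (J : HSModel 𝒦 H) (S T : H ≃ₗᵢ[ℂ] H) :
    ∃ C : 𝒦 →ₗᵢ[ℂ] 𝒦, ∀ k, J.toOp (C k) = (S : H →L[ℂ] H) ∘L J.toOp k ∘L (T : H →L[ℂ] H) := by
  choose C hC using fun k => J.surj ((S : H →L[ℂ] H) ∘L J.toOp k ∘L (T : H →L[ℂ] H)) (by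
    rw [hsNormSq_conj, J.hsNormSq_toOp]
    exact ENNReal.pow_lt_top enorm_lt_top)
  refine ⟨⟨⟨⟨C, fun k k' => J.injective ?_⟩, fun c k => J.injective ?_⟩, fun k => ?_⟩, hC⟩
  · rw [map_add, hC, hC, hC, map_add]
    ext x
    simp
  · rw [RingHom.id_apply, map_smul, hC, hC, map_smul]
    ext x
    simp
  · have h1 := J.hsNormSq_toOp (C k)
    rw [hC, hsNormSq_conj, J.hsNormSq_toOp] at h1
    have h2 := congrArg ENNReal.toReal h1
    simp only [ENNReal.toReal_pow, toReal_enorm] at h2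
    exact (pow_left_inj₀ (norm_nonneg _) (norm_nonneg _) two_ne_zero).1 h2.symm

theorem enorm_sub_sq (J : HSModel 𝒦 H) (k k' : 𝒦) :
    ‖k - k'‖ₑ ^ 2 = hsNormSq (J.toOp k - J.toOp k') := by
  rw [← map_sub, J.hsNormSq_toOp]

variable {l : ℕ}

local notation "𝔼" => EuclideanSpace ℝ (Fin l)

/-- The representation `w ↦ (A ↦ V (a w) A V (b w))` on the Hilbert–Schmidt operators. -/
theorem exists_rep (J : HSModel 𝒦 H) (V : UnitaryRep l H) (a b : 𝔼 × 𝔼 →L[ℝ] 𝔼) :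
    ∃ U : IsometricRep (𝔼 × 𝔼) 𝒦, ∀ w k x, J.toOp (U w k) x = V (a w) (J.toOp k (V (b w) x)) := by
  choose C hC using fun w : 𝔼 × 𝔼 => J.exists_conj (V (a w)) (V (b w))
  have hadd : ∀ (z w : 𝔼 × 𝔼) (ξ : 𝒦), C (z + w) ξ = C z (C w ξ) := by
    intro z w ξ
    apply J.injective
    -- the order of the factors on the right does not matter, as the group is commutative
    rw [hC, hC, hC]
    ext x
    simp only [ContinuousLinearMap.comp_apply, ContinuousLinearEquiv.coe_coe,
      LinearIsometryEquiv.coe_toContinuousLinearEquiv]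
    rw [map_add a, V.map_add, add_comm z w, map_add b, V.map_add]
  refine ⟨⟨C, hadd, fun ξ => ?_⟩, fun w k x => by rw [hC]; rfl⟩
  have h0 : Tendsto (fun w => C w ξ) (𝓝 0) (𝓝 ξ) := by
    rw [tendsto_iff_edist_tendsto_0]
    have h1 := V.tendsto_hsNormSq_conj (A := J.toOp ξ) (by
      rw [J.hsNormSq_toOp]; exact ENNReal.pow_lt_top enorm_lt_top)
      (F := 𝓝 (0 : 𝔼 × 𝔼)) (a := a) (b := b) (by simpa using a.continuous.tendsto 0)
      (by simpa using b.continuous.tendsto 0)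
    simp_rw [← hC, ← J.enorm_sub_sq] at h1
    have h2 := (ENNReal.continuous_rpow_const (y := 1 / 2)).tendsto 0 |>.comp h1
    rw [ENNReal.zero_rpow_of_pos (by norm_num)] at h2
    refine h2.congr fun w => ?_
    rw [Function.comp_apply, edist_eq_enorm_sub, ← ENNReal.rpow_natCast, ← ENNReal.rpow_mul]
    norm_num
  refine continuous_iff_continuousAt.2 fun w₀ => ?_
  have h1 : Tendsto (fun w => C w₀ (C (w - w₀) ξ)) (𝓝 w₀) (𝓝 (C w₀ ξ)) := by
    refine ((C w₀).continuous.tendsto _).comp (h0.comp ?_)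
    simpa using (continuous_sub_right w₀).tendsto w₀
  refine h1.congr fun w => ?_
  rw [← hadd, add_sub_cancel]

/-- The oscillatory integral of `V (a w) A V (b w)` converges strongly, for every Hilbert–Schmidt
operator `A`, and defines an isometry of the Hilbert–Schmidt operators. -/
theorem exists_twist [CompleteSpace 𝒦] (J : HSModel 𝒦 H) (V : UnitaryRep l H)
    (a b : 𝔼 × 𝔼 →L[ℝ] 𝔼) : ∃ T : 𝒦 →ₗᵢ[ℂ] 𝒦, ∀ k x, HasOscIntegral
      (fun y z => V (a (y, z)) (J.toOp k (V (b (y, z)) x))) (J.toOp (T k) x) := by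
  obtain ⟨U, hU⟩ := J.exists_rep V a b
  obtain ⟨T, hT⟩ := U.exists_linearIsometry_hasOscIntegral
  refine ⟨T, fun k x => ?_⟩
  unfold HasOscIntegral
  intro χ hχ
  have h1 : Tendsto (fun ε => J.eval x (U.regularized χ ε k)) (𝓝[>] 0) (𝓝 (J.eval x (T k))) :=
    ((J.eval x).continuous.tendsto _).comp (hT k χ hχ)
  refine h1.congr' ?_
  filter_upwards [self_mem_nhdsWithin] with ε hε
  rw [IsometricRep.regularized, ContinuousLinearMap.map_smul_of_tower,
    ← ContinuousLinearMap.integral_comp_comm _ (U.integrable_regularized χ hε k)]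
  congr 2
  funext w
  rw [map_smul, J.eval_apply, hU]

end HSModel

section Twists

variable {l : ℕ}

theorem isLeftTwist_leftTwist {V : UnitaryRep l H} {Θ : Matrix (Fin l) (Fin l) ℝ}
    {A L : H →L[ℂ] H} (h : IsLeftTwist V Θ A L) : leftTwist V Θ A = L := by
  have h1 : ∃ L, IsLeftTwist V Θ A L := ⟨L, h⟩
  rw [leftTwist, dif_pos h1]
  ext x
  exact IsometricRep.hasOscIntegral_unique (h1.choose_spec x) (h x)

theorem isRightTwist_rightTwist {V : UnitaryRep l H} {Θ : Matrix (Fin l) (Fin l) ℝ}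
    {A R : H →L[ℂ] H} (h : IsRightTwist V Θ A R) : rightTwist V Θ A = R := by
  have h1 : ∃ R, IsRightTwist V Θ A R := ⟨R, h⟩
  rw [rightTwist, dif_pos h1]
  ext x
  exact IsometricRep.hasOscIntegral_unique (h1.choose_spec x) (h x)

/-- `y ↦ ½ Θ y` as a continuous linear map. -/
def halfMulCLM (Θ : Matrix (Fin l) (Fin l) ℝ) :
    EuclideanSpace ℝ (Fin l) →L[ℝ] EuclideanSpace ℝ (Fin l) :=
  (1 / 2 : ℝ) • (Matrix.toEuclideanLin Θ).toContinuousLinearMap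

theorem halfMulCLM_apply (Θ : Matrix (Fin l) (Fin l) ℝ) (y : EuclideanSpace ℝ (Fin l)) :
    halfMulCLM Θ y = halfMul Θ y := rfl

theorem HSModel.exists_leftTwist [CompleteSpace 𝒦] (J : HSModel 𝒦 H) (V : UnitaryRep l H)
    (Θ : Matrix (Fin l) (Fin l) ℝ) :
    ∃ T : 𝒦 →ₗᵢ[ℂ] 𝒦, ∀ k, IsLeftTwist V Θ (J.toOp k) (J.toOp (T k)) := by
  let p := ContinuousLinearMap.fst ℝ (EuclideanSpace ℝ (Fin l)) (EuclideanSpace ℝ (Fin l))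
  let q := ContinuousLinearMap.snd ℝ (EuclideanSpace ℝ (Fin l)) (EuclideanSpace ℝ (Fin l))
  obtain ⟨T, hT⟩ := J.exists_twist V (halfMulCLM Θ ∘L p) (-(halfMulCLM Θ ∘L p) - q)
  refine ⟨T, fun k x => ?_⟩
  simpa only [p, q, ContinuousLinearMap.comp_apply, sub_apply,
    neg_apply, ContinuousLinearMap.coe_fst', ContinuousLinearMap.coe_snd',
    halfMulCLM_apply] using hT k x

theorem HSModel.exists_rightTwist [CompleteSpace 𝒦] (J : HSModel 𝒦 H) (V : UnitaryRep l H)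
    (Θ : Matrix (Fin l) (Fin l) ℝ) :
    ∃ T : 𝒦 →ₗᵢ[ℂ] 𝒦, ∀ k, IsRightTwist V Θ (J.toOp k) (J.toOp (T k)) := by
  let p := ContinuousLinearMap.fst ℝ (EuclideanSpace ℝ (Fin l)) (EuclideanSpace ℝ (Fin l))
  let q := ContinuousLinearMap.snd ℝ (EuclideanSpace ℝ (Fin l)) (EuclideanSpace ℝ (Fin l))
  obtain ⟨T, hT⟩ := J.exists_twist V (-q) (q + halfMulCLM Θ ∘L p)
  refine ⟨T, fun k x => ?_⟩
  simpa only [p, q, ContinuousLinearMap.comp_apply, add_apply,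
    neg_apply, ContinuousLinearMap.coe_fst', ContinuousLinearMap.coe_snd',
    halfMulCLM_apply] using hT k x

end Twists

end Model

/-! ### Riemannian volumes are `σ`-finite -/

section Volume

theorem measurableSet_inter_preimage {X Y : Type*} [TopologicalSpace X] [MeasurableSpace X]
    [BorelSpace X] [TopologicalSpace Y] [MeasurableSpace Y] [BorelSpace Y] {f : X → Y} {U : Set X}
    (hU : MeasurableSet U) (hf : ContinuousOn f U) {s : Set Y} (hs : MeasurableSet s) :
    MeasurableSet (U ∩ f ⁻¹' s) := by
  rw [← Subtype.image_preimage_coe]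
  exact hU.subtype_image ((continuousOn_iff_continuous_domRestrict.1 hf).measurable hs)

variable {n : ℕ} {M : Type*} [EMetricSpace M] [ChartedSpace (EuclideanSpace ℝ (Fin n)) M]
  [IsManifold (𝓡 n) ∞ M] [RiemannianBundle (fun x : M => TangentSpace (𝓡 n) x)]
  [MeasurableSpace M] [BorelSpace M]

/-- A chart domain is covered by the countably many sets on which the coordinates and the density
are bounded, and these have finite volume. -/
theorem IsRiemannianVolume.exists_countable_cover {μ : Measure M}
    (hμ : IsRiemannianVolume (n := n) μ) (x : M) :
    ∃ t : ℕ → Set M, (∀ k, μ (t k) < ⊤) ∧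
      (chartAt (EuclideanSpace ℝ (Fin n)) x).source ⊆ ⋃ k, t k := by
  set c := chartAt (EuclideanSpace ℝ (Fin n)) x
  obtain ⟨g, hg, hle, heq⟩ := exists_measurable_le_withDensity_eq
    (volume : Measure (EuclideanSpace ℝ (Fin n)))
    (fun u => ENNReal.ofReal √(metricMatrix (M := M) c u).det)
  let B : ℕ → Set (EuclideanSpace ℝ (Fin n)) := fun k => {u | g u ≤ k} ∩ Metric.ball 0 k
  have hB : ∀ k, MeasurableSet (B k) := fun k =>
    (measurableSet_le hg measurable_const).inter measurableSet_ball
  refine ⟨fun k => c.source ∩ c ⁻¹' B k, fun k => ?_, fun p hp => ?_⟩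
  · have hs : MeasurableSet (c.source ∩ c ⁻¹' B k) :=
      measurableSet_inter_preimage c.open_source.measurableSet c.continuousOn (hB k)
    have hi : MeasurableSet (c '' (c.source ∩ c ⁻¹' B k)) := by
      rw [c.image_eq_target_inter_inv_preimage Set.inter_subset_left]
      exact measurableSet_inter_preimage c.open_target.measurableSet c.continuousOn_symm hs
    have hsub : c '' (c.source ∩ c ⁻¹' B k) ⊆ B k := by
      rintro _ ⟨p, hp, rfl⟩
      exact hp.2
    rw [hμ c (IsManifold.chart_mem_maximalAtlas x) _ Set.inter_subset_left hs,
      ← withDensity_apply _ hi, ← heq, withDensity_apply _ hi]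
    calc ∫⁻ u in c '' (c.source ∩ c ⁻¹' B k), g u
        ≤ ∫⁻ u in B k, g u := lintegral_mono_set hsub
      _ ≤ ∫⁻ u in B k, (k : ℝ≥0∞) := setLIntegral_mono' (hB k) fun u hu => hu.1
      _ = k * volume (B k) := setLIntegral_const _ _
      _ ≤ k * volume (Metric.ball (0 : EuclideanSpace ℝ (Fin n)) k) := by
          gcongr
          exact Set.inter_subset_right
      _ < ⊤ := ENNReal.mul_lt_top (by simp) measure_ball_lt_top
  · have h1 : g (c p) < ⊤ := (hle _).trans_lt ENNReal.ofReal_lt_top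
    obtain ⟨k₁, hk₁⟩ := ENNReal.exists_nat_gt h1.ne
    obtain ⟨k₂, hk₂⟩ := exists_nat_gt ‖c p‖
    refine Set.mem_iUnion.2 ⟨max k₁ k₂, hp, ?_, ?_⟩
    · refine hk₁.le.trans ?_
      exact_mod_cast le_max_left k₁ k₂
    · rw [mem_ball_zero_iff]
      refine hk₂.trans_le ?_
      exact_mod_cast le_max_right k₁ k₂

/-- A Riemannian volume is `σ`-finite. (The density need not be measurable for this argument: the
lower integral does not notice if it is replaced with a measurable minorant.) -/
theorem IsRiemannianVolume.sigmaFinite [SecondCountableTopology M] {μ : Measure M}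
    (hμ : IsRiemannianVolume (n := n) μ) : SigmaFinite μ := by
  choose t ht hcov using hμ.exists_countable_cover
  obtain ⟨T, hT, hU⟩ := TopologicalSpace.countable_cover_nhds
    (f := fun x : M => (chartAt (EuclideanSpace ℝ (Fin n)) x).source)
    (fun x => chart_source_mem_nhds _ x)
  refine Measure.sigmaFinite_of_countable (S := ⋃ x ∈ T, Set.range (t x))
    (hT.biUnion fun x _ => Set.countable_range _) ?_ ?_
  · intro s hs
    simp only [Set.mem_iUnion, Set.mem_range] at hs
    obtain ⟨x, -, k, rfl⟩ := hs
    exact ht x k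
  · refine Set.eq_univ_of_forall fun p => ?_
    have hp : p ∈ ⋃ x ∈ T, (chartAt (EuclideanSpace ℝ (Fin n)) x).source := hU ▸ Set.mem_univ p
    simp only [Set.mem_iUnion] at hp
    obtain ⟨x, hx, hp⟩ := hp
    obtain ⟨k, hk⟩ := Set.mem_iUnion.1 (hcov x hp)
    exact ⟨t x k, Set.mem_biUnion hx ⟨k, rfl⟩, hk⟩

end Volume

/-! ### Measurable orthonormal frames -/

section Frames

theorem measurable_of_continuousOn_cover {X Y ι : Type*} [Countable ι] [TopologicalSpace X]
    [MeasurableSpace X] [BorelSpace X] [TopologicalSpace Y] [MeasurableSpace Y] [BorelSpace Y]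
    {f : X → Y} (A : ι → Set X) (hA : ∀ k, MeasurableSet (A k)) (hc : ∀ x, ∃ k, x ∈ A k)
    (hf : ∀ k, ContinuousOn f (A k)) : Measurable f := by
  intro s hs
  have : f ⁻¹' s = ⋃ k, A k ∩ f ⁻¹' s := by
    rw [← Set.iUnion_inter, Set.iUnion_eq_univ_iff.2 hc, Set.univ_inter]
  rw [this]
  exact .iUnion fun k => measurableSet_inter_preimage (hA k) (hf k) hs

variable {M : Type*} [TopologicalSpace M]
  {F : Type*} [NormedAddCommGroup F] [NormedSpace ℂ F]
  {S : M → Type*} [TopologicalSpace (TotalSpace F S)]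
  [∀ x, NormedAddCommGroup (S x)] [∀ x, InnerProductSpace ℂ (S x)]
  [FiberBundle F S] [VectorBundle ℂ F S]
  [MeasurableSpace M] [BorelSpace M] [SecondCountableTopology M] [FiniteDimensional ℂ F]
  [IsHermitianBundle F S]

theorem IsMeasurableSection.sub {ψ φ : ∀ x, S x} (hψ : IsMeasurableSection F ψ)
    (hφ : IsMeasurableSection F φ) : IsMeasurableSection F fun x => ψ x - φ x := by
  convert! hψ.add (hφ.smul (-1)) using 1
  funext x
  simp [sub_eq_add_neg]

theorem IsMeasurableSection.measurable_inner {ψ φ : ∀ x, S x} (hψ : IsMeasurableSection F ψ)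
    (hφ : IsMeasurableSection F φ) : Measurable fun x => ⟪ψ x, φ x⟫_ℂ := by
  have h1 := (hψ.add hφ).measurable_norm
  have h2 := (hψ.sub hφ).measurable_norm
  have h3 := (hψ.sub (hφ.smul Complex.I)).measurable_norm
  have h4 := (hψ.add (hφ.smul Complex.I)).measurable_norm
  simp only [Pi.add_apply, Pi.smul_apply] at h1 h2 h3 h4
  simp_rw [inner_eq_sum_norm_sq_div_four (𝕜 := ℂ)]
  have h5 := Complex.measurable_ofReal
  simp only [RCLike.I_to_complex, Complex.coe_algebraMap] at *
  fun_prop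

theorem IsMeasurableSection.fun_smul {ψ : ∀ x, S x} {f : M → ℂ} (hf : Measurable f)
    (hψ : IsMeasurableSection F ψ) : IsMeasurableSection F fun x => f x • ψ x := by
  intro x₀
  borelize F
  have := FiniteDimensional.proper ℂ F
  convert! (hf.comp measurable_subtype_coe).smul (hψ x₀) using 2 with x
  exact ((trivializationAt F S x₀).linear ℂ x.2).map_smul _ _

theorem isMeasurableSection_sum {ι : Type*} (t : Finset ι) {ψ : ι → ∀ x, S x}
    (h : ∀ i ∈ t, IsMeasurableSection F (ψ i)) : IsMeasurableSection F fun x => ∑ i ∈ t, ψ i x := by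
  classical
  induction t using Finset.induction_on with
  | empty => simpa only [Finset.sum_empty] using! isMeasurableSection_zero (F := F) (S := S)
  | insert a t ha ih =>
    simp_rw [Finset.sum_insert ha]
    exact (h a (Finset.mem_insert_self _ _)).add
      (ih fun i hi => h i (Finset.mem_insert_of_mem hi))

variable (F S) in
/-- A measurable choice of one of countably many local trivializations at each point. -/
theorem exists_measurable_index [Nonempty M] : ∃ (c : ℕ → M) (N : M → ℕ), Measurable N ∧
    ∀ x, x ∈ (trivializationAt F S (c (N x))).baseSet := by
  classical
  obtain ⟨T, hT, hU⟩ := TopologicalSpace.countable_cover_nhds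
    (f := fun x₀ : M => (trivializationAt F S x₀).baseSet)
    (fun x₀ => (trivializationAt F S x₀).open_baseSet.mem_nhds
      (FiberBundle.mem_baseSet_trivializationAt' x₀))
  have hne : T.Nonempty := by
    by_contra h
    rw [Set.not_nonempty_iff_eq_empty] at h
    rw [h, Set.biUnion_empty] at hU
    exact Set.empty_ne_univ hU
  obtain ⟨c, rfl⟩ := hT.exists_eq_range hne
  have hex : ∀ x, ∃ k, x ∈ (trivializationAt F S (c k)).baseSet := by
    intro x
    have : x ∈ ⋃ x₀ ∈ Set.range c, (trivializationAt F S x₀).baseSet := hU ▸ Set.mem_univ x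
    simpa using this
  exact ⟨c, fun x => Nat.find (hex x),
    measurable_find hex fun k => (trivializationAt F S (c k)).open_baseSet.measurableSet,
    fun x => Nat.find_spec (hex x)⟩

variable (F S) in
/-- A measurable trivialization of `S` over all of `M`, glued from local trivializations over a
countable measurable partition. -/
theorem exists_measurable_trivialization : ∃ L : ∀ x, F ≃L[ℂ] S x,
    ∀ v, IsMeasurableSection F fun x => L x v := by
  classical
  rcases isEmpty_or_nonempty M with hM | hM
  · exact ⟨fun x => (hM.false x).elim, fun v x₀ => (hM.false x₀).elim⟩
  obtain ⟨c, N, hN, hc⟩ := exists_measurable_index F S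
  refine ⟨fun x => ((trivializationAt F S (c (N x))).continuousLinearEquivAt ℂ x (hc x)).symm,
    fun v x₀ => ?_⟩
  borelize F
  refine measurable_of_continuousOn_cover
    (fun k : ℕ => {x : (trivializationAt F S x₀).baseSet | N x = k})
    (fun k => (hN.comp measurable_subtype_coe) (measurableSet_singleton k)) (fun x => ⟨_, rfl⟩)
    fun k => ?_
  set e₀ := trivializationAt F S x₀
  set e := trivializationAt F S (c k)
  have h1 : ContinuousOn (fun x : e₀.baseSet => e.toOpenPartialHomeomorph.symm ((x : M), v))
      {x : e₀.baseSet | N x = k} := by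
    refine e.toOpenPartialHomeomorph.symm.continuousOn.comp (by fun_prop) ?_
    rintro x rfl
    simpa [e.target_eq, e] using hc x
  have h2 : ∀ x : e₀.baseSet, N x = k →
      e.toOpenPartialHomeomorph.symm ((x : M), v) =
        ⟨x, ((trivializationAt F S (c (N x))).continuousLinearEquivAt ℂ x (hc x)).symm v⟩ := by
    rintro x rfl
    rw [Trivialization.symm_continuousLinearEquivAt_eq, Trivialization.symmL_apply _ (hc x)]
    exact ((trivializationAt F S (c (N x))).mk_symm (hc x) v).symm
  have h3 : ContinuousOn (fun x : e₀.baseSet => e₀ (e.toOpenPartialHomeomorph.symm ((x : M), v)))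
      {x : e₀.baseSet | N x = k} := by
    refine e₀.continuousOn.comp h1 fun x hx => ?_
    rw [h2 x hx]
    exact e₀.mem_source.2 x.2
  refine (continuous_snd.comp_continuousOn h3).congr fun x hx => ?_
  simp only [Function.comp_apply]
  rw [h2 x hx]

open InnerProductSpace in
theorem isMeasurableSection_gramSchmidt {d : ℕ} {ψ : Fin d → ∀ x, S x}
    (h : ∀ i, IsMeasurableSection F (ψ i)) (i : Fin d) :
    IsMeasurableSection F fun x => gramSchmidt ℂ (fun i => ψ i x) i := by
  induction i using WellFoundedLT.induction with
  | ind i ih =>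
    have h1 : (fun x => gramSchmidt ℂ (fun i => ψ i x) i) = fun x => ψ i x -
        ∑ j ∈ Finset.Iio i, (⟪gramSchmidt ℂ (fun i => ψ i x) j, ψ i x⟫_ℂ /
          ((‖gramSchmidt ℂ (fun i => ψ i x) j‖ ^ 2 : ℝ) : ℂ)) •
            gramSchmidt ℂ (fun i => ψ i x) j := by
      funext x
      rw [gramSchmidt_def]
      simp only [Submodule.starProjection_singleton]
      rfl
    rw [h1]
    refine (h i).sub (isMeasurableSection_sum _ fun j hj => ?_)
    have hj' := ih j (Finset.mem_Iio.1 hj)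
    refine hj'.fun_smul ((hj'.measurable_inner (h i)).div ?_)
    exact Complex.measurable_ofReal.comp (hj'.measurable_norm.pow_const 2)

open InnerProductSpace in
variable (F S) in
/-- A Hermitian vector bundle has a measurable orthonormal frame. -/
theorem exists_measurable_orthonormal_frame :
    ∃ s : ∀ x, OrthonormalBasis (Fin (Module.finrank ℂ F)) ℂ (S x),
      ∀ i, IsMeasurableSection F fun x => s x i := by
  obtain ⟨L, hL⟩ := exists_measurable_trivialization F S
  let b := Module.finBasis ℂ F
  have hli : ∀ x, LinearIndependent ℂ fun i => L x (b i) := fun x =>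
    b.linearIndependent.map' (L x).toLinearEquiv.toLinearMap (L x).toLinearEquiv.ker
  have hon : ∀ x, Orthonormal ℂ (gramSchmidtNormed ℂ fun i => L x (b i)) :=
    fun x => gramSchmidtNormed_orthonormal (hli x)
  have hsp : ∀ x, ⊤ ≤ Submodule.span ℂ (Set.range (gramSchmidtNormed ℂ fun i => L x (b i))) := by
    intro x
    rw [span_gramSchmidtNormed_range, span_gramSchmidt]
    have h1 : (Set.range fun i => L x (b i)) = (L x).toLinearEquiv.toLinearMap '' Set.range b := by
      rw [← Set.range_comp]; rfl
    rw [h1, Submodule.span_image, b.span_eq, Submodule.map_top, LinearEquiv.range]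
  refine ⟨fun x => OrthonormalBasis.mk (hon x) (hsp x), fun i => ?_⟩
  simp only [OrthonormalBasis.coe_mk]
  have hg := isMeasurableSection_gramSchmidt (fun i => hL (b i)) i
  exact hg.fun_smul (Complex.measurable_ofReal.comp hg.measurable_norm).inv

end Frames

/-! ### Tensor products and Hilbert–Schmidt operators -/

section Tensor

theorem norm_eq_mul_norm_of_inner_self {E E' : Type*} [SeminormedAddCommGroup E]
    [InnerProductSpace ℂ E] [NormedAddCommGroup E'] [InnerProductSpace ℂ E'] {k : E'} {x y : E}
    (h : ⟪k, k⟫_ℂ = ⟪x, x⟫_ℂ * ⟪y, y⟫_ℂ) : ‖k‖ = ‖x‖ * ‖y‖ := by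
  rw [inner_self_eq_norm_sq_to_K, inner_self_eq_norm_sq_to_K, inner_self_eq_norm_sq_to_K,
    ← mul_pow] at h
  have h2 : ‖k‖ ^ 2 = (‖x‖ * ‖y‖) ^ 2 := by
    apply Complex.ofReal_injective
    simpa using h
  exact (pow_left_inj₀ (norm_nonneg _) (by positivity) two_ne_zero).1 h2

/-- A model `𝒦` of the Hilbert tensor product of `H` with its conjugate, whose vectors will be the
kernels of the Hilbert–Schmidt operators on `H`: the vector `tmul φ ψ` stands for `|φ⟩⟨ψ|`. -/
structure TensorModel (𝒦 H : Type*) [NormedAddCommGroup H] [InnerProductSpace ℂ H]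
    [NormedAddCommGroup 𝒦] [InnerProductSpace ℂ 𝒦] where
  /-- the elementary tensors -/
  tmul : H → H → 𝒦
  add_left : ∀ φ φ' ψ, tmul (φ + φ') ψ = tmul φ ψ + tmul φ' ψ
  smul_left : ∀ (c : ℂ) φ ψ, tmul (c • φ) ψ = c • tmul φ ψ
  add_right : ∀ φ ψ ψ', tmul φ (ψ + ψ') = tmul φ ψ + tmul φ ψ'
  smul_right : ∀ (c : ℂ) φ ψ, tmul φ (c • ψ) = starRingEnd ℂ c • tmul φ ψ
  inner_tmul : ∀ φ ψ φ' ψ', ⟪tmul φ ψ, tmul φ' ψ'⟫_ℂ = ⟪φ, φ'⟫_ℂ * ⟪ψ', ψ⟫_ℂ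
  total : ∀ k, (∀ φ ψ, ⟪tmul φ ψ, k⟫_ℂ = 0) → k = 0

namespace TensorModel

variable {H 𝒦 : Type*} [NormedAddCommGroup H] [InnerProductSpace ℂ H] [CompleteSpace H]
  [NormedAddCommGroup 𝒦] [InnerProductSpace ℂ 𝒦] [CompleteSpace 𝒦]

theorem norm_tmul (t : TensorModel 𝒦 H) (φ ψ : H) : ‖t.tmul φ ψ‖ = ‖φ‖ * ‖ψ‖ := by
  exact norm_eq_mul_norm_of_inner_self (t.inner_tmul φ ψ φ ψ)

/-- The map `φ ↦ tmul φ ψ`. -/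
def leftMap (t : TensorModel 𝒦 H) (ψ : H) : H →L[ℂ] 𝒦 :=
  LinearMap.mkContinuous
    { toFun := fun φ => t.tmul φ ψ
      map_add' := fun φ φ' => t.add_left φ φ' ψ
      map_smul' := fun c φ => t.smul_left c φ ψ } ‖ψ‖ fun φ => by
    simp [t.norm_tmul, mul_comm]

theorem leftMap_apply (t : TensorModel 𝒦 H) (φ ψ : H) : t.leftMap ψ φ = t.tmul φ ψ := rfl

/-- The operator with the matrix elements `⟪φ, A ψ⟫ = ⟪tmul φ ψ, k⟫`. -/
def op (t : TensorModel 𝒦 H) (k : 𝒦) : H →L[ℂ] H :=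
  LinearMap.mkContinuous
    { toFun := fun ψ => ContinuousLinearMap.adjoint (t.leftMap ψ) k
      map_add' := fun ψ ψ' => by
        refine ext_inner_left ℂ fun φ => ?_
        rw [inner_add_right]
        simp only [ContinuousLinearMap.adjoint_inner_right, leftMap_apply]
        rw [t.add_right, inner_add_left]
      map_smul' := fun c ψ => by
        refine ext_inner_left ℂ fun φ => ?_
        rw [RingHom.id_apply, inner_smul_right]
        simp only [ContinuousLinearMap.adjoint_inner_right, leftMap_apply]
        rw [t.smul_right, inner_smul_left, RCLike.conj_conj] } ‖k‖ fun ψ => by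
    refine ((ContinuousLinearMap.adjoint (t.leftMap ψ)).le_opNorm k).trans ?_
    rw [LinearIsometryEquiv.norm_map, mul_comm]
    gcongr
    exact LinearMap.mkContinuous_norm_le _ (norm_nonneg _) _

theorem inner_op (t : TensorModel 𝒦 H) (k : 𝒦) (φ ψ : H) :
    ⟪φ, t.op k ψ⟫_ℂ = ⟪t.tmul φ ψ, k⟫_ℂ :=
  ContinuousLinearMap.adjoint_inner_right (t.leftMap ψ) φ k

theorem op_eq_iff (t : TensorModel 𝒦 H) (k : 𝒦) (A : H →L[ℂ] H) :
    t.op k = A ↔ ∀ φ ψ, ⟪φ, A ψ⟫_ℂ = ⟪t.tmul φ ψ, k⟫_ℂ := by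
  constructor
  · rintro rfl φ ψ
    exact t.inner_op k φ ψ
  · intro h
    ext ψ
    exact ext_inner_left ℂ fun φ => by rw [t.inner_op, h]

/-- Operators with the same matrix in an orthonormal basis are equal. -/
theorem eq_of_basis {ι : Type*} (e : HilbertBasis ι ℂ H) {A B : H →L[ℂ] H}
    (h : ∀ i j, ⟪e i, A (e j)⟫_ℂ = ⟪e i, B (e j)⟫_ℂ) : A = B := by
  have h1 : ∀ j, A (e j) = B (e j) := fun j => by
    apply e.repr.injective
    ext i
    rw [e.repr_apply_apply, e.repr_apply_apply, h]
  refine ContinuousLinearMap.ext_on (s := Set.range e) ?_ ?_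
  · rw [dense_iff_closure_eq, ← Submodule.topologicalClosure_coe, e.dense_span]
    rfl
  · rintro _ ⟨j, rfl⟩
    exact h1 j

open Classical in
theorem orthonormal_tmul (t : TensorModel 𝒦 H) {ι : Type*} (e : HilbertBasis ι ℂ H) :
    Orthonormal ℂ fun p : ι × ι => t.tmul (e p.1) (e p.2) := by
  rw [orthonormal_iff_ite]
  intro p q
  rw [t.inner_tmul, orthonormal_iff_ite.1 e.orthonormal, orthonormal_iff_ite.1 e.orthonormal]
  simp only [Prod.ext_iff, eq_comm (a := q.2)]
  split_ifs <;> simp_all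

/-- The tensors `tmul (e i) (e j)` form an orthonormal basis. -/
def basis (t : TensorModel 𝒦 H) {ι : Type*} (e : HilbertBasis ι ℂ H) :
    HilbertBasis (ι × ι) ℂ 𝒦 :=
  HilbertBasis.mkOfOrthogonalEqBot (t.orthonormal_tmul e) (by
    rw [Submodule.eq_bot_iff]
    intro k hk
    have h1 : ∀ i j, ⟪t.tmul (e i) (e j), k⟫_ℂ = 0 := fun i j =>
      (Submodule.mem_orthogonal _ k).1 hk _ (Submodule.subset_span ⟨(i, j), rfl⟩)
    have h2 : t.op k = 0 := eq_of_basis e fun i j => by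
      rw [t.inner_op, h1]; simp
    refine t.total k fun φ ψ => ?_
    rw [← t.inner_op, h2]; simp)

theorem basis_apply (t : TensorModel 𝒦 H) {ι : Type*} (e : HilbertBasis ι ℂ H) (p : ι × ι) :
    t.basis e p = t.tmul (e p.1) (e p.2) := by
  rw [basis, HilbertBasis.coe_mkOfOrthogonalEqBot]

theorem hsNormSq_eq_tsum_prod {ι : Type*} (e : HilbertBasis ι ℂ H) (A : H →L[ℂ] H) :
    hsNormSq A = ∑' p : ι × ι, ‖⟪e p.1, A (e p.2)⟫_ℂ‖ₑ ^ 2 := by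
  rw [hsNormSq_eq_tsum e, ENNReal.tsum_prod', ENNReal.tsum_comm]
  exact tsum_congr fun j => (tsum_enorm_inner_sq e _).symm

/-- The Hilbert–Schmidt norm is the norm of the tensor product: both are the sum of the squares of
the matrix elements. -/
theorem hsNormSq_op (t : TensorModel 𝒦 H) (k : 𝒦) : hsNormSq (t.op k) = ‖k‖ₑ ^ 2 := by
  obtain ⟨w, e, -⟩ := exists_hilbertBasis ℂ H
  rw [hsNormSq_eq_tsum_prod e, ← tsum_enorm_inner_sq (t.basis e)]
  refine tsum_congr fun p => ?_
  rw [t.inner_op, t.basis_apply]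

/-- A Hilbert–Schmidt operator comes from the vector whose coordinates are its matrix elements. -/
theorem exists_op_eq (t : TensorModel 𝒦 H) (A : H →L[ℂ] H) (hA : hsNormSq A < ⊤) :
    ∃ k, t.op k = A := by
  obtain ⟨w, e, -⟩ := exists_hilbertBasis ℂ H
  rw [hsNormSq_eq_tsum_prod e] at hA
  have hmem : Memℓp (fun p : w × w => ⟪e p.1, A (e p.2)⟫_ℂ) 2 := by
    refine memℓp_gen ?_
    have h1 := ENNReal.summable_toReal hA.ne
    simpa using h1
  refine ⟨(t.basis e).repr.symm ⟨_, hmem⟩, eq_of_basis e fun i j => ?_⟩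
  rw [t.inner_op, ← t.basis_apply e (i, j), ← HilbertBasis.repr_apply_apply,
    LinearIsometryEquiv.apply_symm_apply]

/-- The vectors of the tensor product are the Hilbert–Schmidt operators. -/
def hsModel (t : TensorModel 𝒦 H) : HSModel 𝒦 H where
  toOp :=
    { toFun := t.op
      map_add' := fun k k' => by
        rw [op_eq_iff]
        intro φ ψ
        rw [inner_add_right, ← t.inner_op, ← t.inner_op, ← inner_add_right]
        rfl
      map_smul' := fun c k => by
        rw [op_eq_iff]
        intro φ ψ
        rw [inner_smul_right, ← t.inner_op, ← inner_smul_right]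
        rfl }
  hsNormSq_toOp := t.hsNormSq_op
  surj := t.exists_op_eq

theorem hsModel_toOp (t : TensorModel 𝒦 H) (k : 𝒦) : t.hsModel.toOp k = t.op k := rfl

end TensorModel

end Tensor

section Rectangles

theorem ae_eq_zero_of_setIntegral_prod {X : Type*} [MeasurableSpace X] {μ : Measure X}
    [IsFiniteMeasure μ] {g : X × X → ℂ} (hg : Integrable g (μ.prod μ))
    (h : ∀ U W, MeasurableSet U → MeasurableSet W → ∫ z in U ×ˢ W, g z ∂(μ.prod μ) = 0) :
    g =ᵐ[μ.prod μ] 0 := by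
  refine hg.ae_eq_zero_of_forall_setIntegral_eq_zero fun s hs _ => ?_
  have huniv : ∫ z, g z ∂(μ.prod μ) = 0 := by
    simpa using h Set.univ Set.univ .univ .univ
  induction s, hs using MeasurableSpace.induction_on_inter generateFrom_prod.symm
    isPiSystem_prod with
  | empty => simp
  | basic t ht =>
    obtain ⟨U, hU, W, hW, rfl⟩ := ht
    exact h U W hU hW
  | compl t ht ih =>
    rw [setIntegral_compl ht hg, huniv, ih (measure_lt_top _ _), sub_zero]
  | iUnion f hd hm ih =>
    rw [integral_iUnion hm hd hg.integrableOn]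
    simp [fun i => ih i (measure_lt_top _ _)]

end Rectangles

/-! ### Operators between the fibers -/

section HomCoord

variable {ι E E' : Type*} [Fintype ι] [NormedAddCommGroup E] [InnerProductSpace ℂ E]
  [NormedAddCommGroup E'] [InnerProductSpace ℂ E']

/-- The matrix of an operator in orthonormal bases, as a vector whose Euclidean norm is the
Hilbert–Schmidt norm. -/
def homCoord (e : OrthonormalBasis ι ℂ E) (f : OrthonormalBasis ι ℂ E') :
    (E' →L[ℂ] E) →ₗ[ℂ] EuclideanSpace ℂ (ι × ι) where
  toFun B := WithLp.toLp 2 fun q => ⟪e q.1, B (f q.2)⟫_ℂ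
  map_add' B B' := by
    ext q
    simp
  map_smul' c B := by
    ext q
    simp

@[simp]
theorem homCoord_apply (e : OrthonormalBasis ι ℂ E) (f : OrthonormalBasis ι ℂ E')
    (B : E' →L[ℂ] E) (q : ι × ι) : homCoord e f B q = ⟪e q.1, B (f q.2)⟫_ℂ := rfl

/-- The operator with a given matrix. -/
def homOfCoord (e : OrthonormalBasis ι ℂ E) (f : OrthonormalBasis ι ℂ E')
    (c : EuclideanSpace ℂ (ι × ι)) : E' →L[ℂ] E :=
  ∑ q, c q • InnerProductSpace.rankOne ℂ (e q.1) (f q.2)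

theorem inner_homOfCoord (e : OrthonormalBasis ι ℂ E) (f : OrthonormalBasis ι ℂ E')
    (c : EuclideanSpace ℂ (ι × ι)) (x : E) (y : E') :
    ⟪x, homOfCoord e f c y⟫_ℂ = ∑ q, c q * (⟪f q.2, y⟫_ℂ * ⟪x, e q.1⟫_ℂ) := by
  simp [homOfCoord]

theorem homCoord_homOfCoord (e : OrthonormalBasis ι ℂ E) (f : OrthonormalBasis ι ℂ E')
    (c : EuclideanSpace ℂ (ι × ι)) : homCoord e f (homOfCoord e f c) = c := by
  classical
  ext q
  rw [homCoord_apply, inner_homOfCoord, Finset.sum_eq_single q]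
  · simp
  · intro q' _ h
    rw [f.inner_eq_ite, e.inner_eq_ite]
    by_cases h1 : q'.2 = q.2
    · have h2 : q.1 ≠ q'.1 := fun h2 => h (Prod.ext h2.symm h1)
      simp [h2]
    · simp [h1]
  · simp

/-- The Hilbert–Schmidt inner product with `|x⟩⟨y|` is the matrix element at `x` and `y`. -/
theorem inner_homCoord_rankOne (e : OrthonormalBasis ι ℂ E) (f : OrthonormalBasis ι ℂ E')
    (B : E' →L[ℂ] E) (x : E) (y : E') :
    ⟪homCoord e f (InnerProductSpace.rankOne ℂ x y), homCoord e f B⟫_ℂ = ⟪x, B y⟫_ℂ := by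
  have h1 : B y = ∑ j, ⟪f j, y⟫_ℂ • B (f j) := by
    conv_lhs => rw [← f.sum_repr' y]
    simp
  rw [PiLp.inner_apply, Fintype.sum_prod_type_right, h1, inner_sum]
  refine Finset.sum_congr rfl fun j _ => ?_
  rw [inner_smul_right, ← e.sum_inner_mul_inner, Finset.mul_sum]
  refine Finset.sum_congr rfl fun i _ => ?_
  simp only [homCoord_apply, InnerProductSpace.rankOne_apply, inner_smul_right, RCLike.inner_apply,
    map_mul, inner_conj_symm]
  ring

theorem enorm_homCoord_sq [CompleteSpace E] [CompleteSpace E'] (e : OrthonormalBasis ι ℂ E)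
    (f : OrthonormalBasis ι ℂ E') (B : E' →L[ℂ] E) :
    ‖homCoord e f B‖ₑ ^ 2 = hsNormSq B := by
  classical
  rw [hsNormSq_eq_tsum f.toHilbertBasis, tsum_fintype]
  simp_rw [← tsum_enorm_inner_sq e.toHilbertBasis, tsum_fintype]
  rw [← Fintype.sum_prod_type_right (f := fun q : ι × ι =>
    ‖⟪e.toHilbertBasis q.1, B (f.toHilbertBasis q.2)⟫_ℂ‖ₑ ^ 2)]
  rw [← ofReal_norm, ← ENNReal.ofReal_pow (norm_nonneg _), EuclideanSpace.norm_sq_eq,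
    ENNReal.ofReal_sum_of_nonneg fun _ _ => by positivity]
  refine Finset.sum_congr rfl fun q _ => ?_
  rw [ENNReal.ofReal_pow (norm_nonneg _), ofReal_norm]
  simp

end HomCoord

/-! ### Square integrable kernels in a frame -/

section LpNorm

theorem enorm_toLp_sq {X E : Type*} [MeasurableSpace X] [NormedAddCommGroup E] {ν : Measure X}
    {f : X → E} (hf : MemLp f 2 ν) : ‖hf.toLp f‖ₑ ^ 2 = ∫⁻ x, ‖f x‖ₑ ^ 2 ∂ν := by
  rw [Lp.enorm_toLp, eLpNorm_eq_lintegral_rpow_enorm_toReal two_ne_zero ENNReal.ofNat_ne_top,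
    ← ENNReal.rpow_natCast, ← ENNReal.rpow_mul]
  simp

theorem memLp_two_of_lintegral {X E : Type*} [MeasurableSpace X] [NormedAddCommGroup E]
    {ν : Measure X} {f : X → E} (hf : AEStronglyMeasurable f ν) (h : ∫⁻ x, ‖f x‖ₑ ^ 2 ∂ν < ⊤) :
    MemLp f 2 ν := by
  refine ⟨hf, ?_⟩
  rw [eLpNorm_lt_top_iff_lintegral_rpow_enorm_lt_top two_ne_zero ENNReal.ofNat_ne_top]
  simpa using h

end LpNorm

section KernelSpace

variable {M : Type*} [TopologicalSpace M] [MeasurableSpace M] [BorelSpace M]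
  [SecondCountableTopology M]
  {F : Type*} [NormedAddCommGroup F] [NormedSpace ℂ F] [FiniteDimensional ℂ F]
  {S : M → Type*} [TopologicalSpace (TotalSpace F S)]
  [∀ x, NormedAddCommGroup (S x)] [∀ x, InnerProductSpace ℂ (S x)]
  [FiberBundle F S] [VectorBundle ℂ F S] [IsHermitianBundle F S]
  {μ : Measure M}

theorem completeSpace_fiber {M : Type*} [TopologicalSpace M]
    (F : Type*) [NormedAddCommGroup F] [NormedSpace ℂ F] [FiniteDimensional ℂ F]
    (S : M → Type*) [TopologicalSpace (TotalSpace F S)]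
    [∀ x, NormedAddCommGroup (S x)] [∀ x, InnerProductSpace ℂ (S x)]
    [FiberBundle F S] [VectorBundle ℂ F S] (x : M) : CompleteSpace (S x) :=
  have : FiniteDimensional ℂ (S x) :=
    (VectorBundle.continuousLinearEquivAt ℂ F S x).symm.toLinearEquiv.finiteDimensional
  FiniteDimensional.complete ℂ (S x)

variable (F S) in
/-- A measurable orthonormal frame of a Hermitian bundle. -/
structure OrthonormalFrame (ι : Type*) [Fintype ι] where
  /-- the orthonormal bases of the fibers -/
  basis : ∀ x, OrthonormalBasis ι ℂ (S x)
  measurable_basis : ∀ i, IsMeasurableSection F fun x => basis x i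

namespace OrthonormalFrame

variable {ι : Type*} [Fintype ι] (s : OrthonormalFrame F S ι)

/-- The components of a kernel in a frame. -/
def coord (K : ∀ p p' : M, S p' →L[ℂ] S p) (z : M × M) : EuclideanSpace ℂ (ι × ι) :=
  homCoord (s.basis z.1) (s.basis z.2) (K z.1 z.2)

theorem enorm_coord_sq (K : ∀ p p' : M, S p' →L[ℂ] S p) (z : M × M) :
    ‖s.coord K z‖ₑ ^ 2 = hsNormSq (K z.1 z.2) :=
  have := completeSpace_fiber F S z.1
  have := completeSpace_fiber F S z.2
  enorm_homCoord_sq _ _ _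

theorem memLp_coord (K : L2Kernel F S μ) : MemLp (s.coord K.toFun) 2 (μ.prod μ) := by
  refine memLp_two_of_lintegral (Measurable.aestronglyMeasurable ?_) ?_
  · refine (WithLp.measurable_toLp 2 _).comp (measurable_pi_lambda _ fun q => ?_)
    exact K.measurable_toFun _ _ (s.measurable_basis q.1) (s.measurable_basis q.2)
  · simpa only [s.enorm_coord_sq] using K.lintegral_lt_top

/-- The components of a square integrable kernel, as a vector in an `L²` space. -/
def ofKernel (K : L2Kernel F S μ) : Lp (EuclideanSpace ℂ (ι × ι)) 2 (μ.prod μ) :=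
  (s.memLp_coord K).toLp _

theorem enorm_ofKernel_sq (K : L2Kernel F S μ) :
    ‖s.ofKernel K‖ₑ ^ 2 = ∫⁻ z, hsNormSq (K.toFun z.1 z.2) ∂(μ.prod μ) := by
  rw [ofKernel, enorm_toLp_sq]
  simp_rw [s.enorm_coord_sq]

theorem enorm_ofKernel_sub_sq (K K' : L2Kernel F S μ) :
    ‖s.ofKernel K - s.ofKernel K'‖ₑ ^ 2 =
      ∫⁻ z, hsNormSq (K.toFun z.1 z.2 - K'.toFun z.1 z.2) ∂(μ.prod μ) := by
  rw [ofKernel, ofKernel, ← MemLp.toLp_sub, enorm_toLp_sq]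
  refine lintegral_congr fun z => ?_
  rw [← s.enorm_coord_sq fun p p' => K.toFun p p' - K'.toFun p p', coord, map_sub]
  rfl

theorem ofKernel_add {K K₁ K₂ : L2Kernel F S μ}
    (h : ∀ p p', K.toFun p p' = K₁.toFun p p' + K₂.toFun p p') :
    s.ofKernel K = s.ofKernel K₁ + s.ofKernel K₂ := by
  rw [ofKernel, ofKernel, ofKernel, ← MemLp.toLp_add]
  refine MemLp.toLp_congr _ _ (ae_of_all _ fun z => ?_)
  simp only [coord, h, map_add, Pi.add_apply]

theorem ofKernel_smul {K K₁ : L2Kernel F S μ} (c : ℂ)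
    (h : ∀ p p', K.toFun p p' = c • K₁.toFun p p') :
    s.ofKernel K = c • s.ofKernel K₁ := by
  rw [ofKernel, ofKernel, ← MemLp.toLp_const_smul]
  refine MemLp.toLp_congr _ _ (ae_of_all _ fun z => ?_)
  simp only [coord, h, map_smul, Pi.smul_apply]

/-- The square integrable kernel with given components. It is formed from the strongly measurable
representative of `k`, so that it is measurable and not only almost everywhere so. -/
def toKernel (k : Lp (EuclideanSpace ℂ (ι × ι)) 2 (μ.prod μ)) : L2Kernel F S μ where
  toFun p p' := homOfCoord (s.basis p) (s.basis p') (k (p, p'))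
  measurable_toFun φ ψ hφ hψ := by
    simp_rw [inner_homOfCoord]
    refine Finset.measurable_fun_sum _ fun q _ => ?_
    refine Measurable.mul ?_ (Measurable.mul ?_ ?_)
    · exact (EuclideanSpace.proj (𝕜 := ℂ) q).continuous.measurable.comp
        (Lp.stronglyMeasurable k).measurable
    · exact ((s.measurable_basis q.2).measurable_inner hψ).comp measurable_snd
    · exact (hφ.measurable_inner (s.measurable_basis q.1)).comp measurable_fst
  lintegral_lt_top := by
    have h : ∀ z : M × M, hsNormSq (homOfCoord (s.basis z.1) (s.basis z.2) (k (z.1, z.2))) =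
        ‖k z‖ₑ ^ 2 := fun z => by
      rw [← s.enorm_coord_sq fun p p' => homOfCoord (s.basis p) (s.basis p') (k (p, p')), coord,
        homCoord_homOfCoord]
    simp_rw [h]
    rw [← enorm_toLp_sq (Lp.memLp k)]
    exact ENNReal.pow_lt_top enorm_lt_top

theorem ofKernel_toKernel (k : Lp (EuclideanSpace ℂ (ι × ι)) 2 (μ.prod μ)) :
    s.ofKernel (s.toKernel k) = k := by
  conv_rhs => rw [← Lp.toLp_coeFn k (Lp.memLp k)]
  exact MemLp.toLp_congr _ _ (ae_of_all _ fun z => homCoord_homOfCoord _ _ _)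

end OrthonormalFrame

theorem hsNormSq_rankOne {E E' : Type*} [NormedAddCommGroup E] [InnerProductSpace ℂ E]
    [NormedAddCommGroup E'] [InnerProductSpace ℂ E'] [CompleteSpace E] [CompleteSpace E']
    (x : E) (y : E') : hsNormSq (InnerProductSpace.rankOne ℂ x y) = ‖x‖ₑ ^ 2 * ‖y‖ₑ ^ 2 := by
  obtain ⟨w, e, -⟩ := exists_hilbertBasis ℂ E'
  rw [hsNormSq_eq_tsum e, ← tsum_enorm_inner_sq e y, ← ENNReal.tsum_mul_left]
  refine tsum_congr fun i => ?_
  rw [InnerProductSpace.rankOne_apply, enorm_smul, mul_pow, mul_comm, ← inner_conj_symm,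
    RCLike.enorm_conj]

variable [SigmaFinite μ]

/-- The kernel `|φ(p)⟩⟨ψ(p')|`. -/
def tensorKernel (φ ψ : SqIntegrableSection F S μ) : L2Kernel F S μ where
  toFun p p' := InnerProductSpace.rankOne ℂ (φ p) (ψ p')
  measurable_toFun φ' ψ' hφ hψ := by
    simp only [InnerProductSpace.rankOne_apply, inner_smul_right]
    exact ((ψ.2.1.measurable_inner hψ).comp measurable_snd).mul
      ((hφ.measurable_inner φ.2.1).comp measurable_fst)
  lintegral_lt_top := by
    have h : ∀ z : M × M, hsNormSq (InnerProductSpace.rankOne ℂ (φ z.1) (ψ z.2)) =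
        ‖φ z.1‖ₑ ^ 2 * ‖ψ z.2‖ₑ ^ 2 := fun z =>
      have := completeSpace_fiber F S z.1
      have := completeSpace_fiber F S z.2
      hsNormSq_rankOne _ _
    simp_rw [h]
    have hm : ∀ ψ : SqIntegrableSection F S μ, Measurable fun x => ‖ψ x‖ₑ ^ 2 := fun ψ => by
      simpa only [ofReal_norm] using ψ.measurable_norm.ennreal_ofReal.pow_const 2
    rw [lintegral_prod_mul (hm φ).aemeasurable (hm ψ).aemeasurable]
    exact ENNReal.mul_lt_top φ.2.2 ψ.2.2

namespace OrthonormalFrame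

variable {ι : Type*} [Fintype ι] (s : OrthonormalFrame F S ι)

theorem inner_ofKernel_tensorKernel (φ ψ : SqIntegrableSection F S μ) (K : L2Kernel F S μ) :
    ⟪s.ofKernel (tensorKernel φ ψ), s.ofKernel K⟫_ℂ =
      ∫ z, ⟪φ z.1, K.toFun z.1 z.2 (ψ z.2)⟫_ℂ ∂(μ.prod μ) := by
  rw [L2.inner_def]
  refine integral_congr_ae ?_
  filter_upwards [(s.memLp_coord K).coeFn_toLp, (s.memLp_coord (tensorKernel φ ψ)).coeFn_toLp]
    with z h1 h2
  rw [ofKernel, ofKernel, h1, h2]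
  exact inner_homCoord_rankOne _ _ _ _ _

theorem inner_tensorKernel (φ ψ φ' ψ' : SqIntegrableSection F S μ) :
    ⟪s.ofKernel (tensorKernel φ ψ), s.ofKernel (tensorKernel φ' ψ')⟫_ℂ =
      ⟪φ, φ'⟫_ℂ * ⟪ψ', ψ⟫_ℂ := by
  rw [inner_ofKernel_tensorKernel, SqIntegrableSection.inner_def, SqIntegrableSection.inner_def,
    ← integral_prod_mul]
  refine integral_congr_ae (ae_of_all _ fun z => ?_)
  simp only [tensorKernel, InnerProductSpace.rankOne_apply, inner_smul_right]
  ring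

theorem ofKernel_tensorKernel_add_left (φ φ' ψ : SqIntegrableSection F S μ) :
    s.ofKernel (tensorKernel (φ + φ') ψ) =
      s.ofKernel (tensorKernel φ ψ) + s.ofKernel (tensorKernel φ' ψ) :=
  s.ofKernel_add fun p p' => by
    ext v
    simp only [tensorKernel, SqIntegrableSection.add_apply, InnerProductSpace.rankOne_apply,
      add_apply, smul_add]

theorem ofKernel_tensorKernel_add_right (φ ψ ψ' : SqIntegrableSection F S μ) :
    s.ofKernel (tensorKernel φ (ψ + ψ')) =
      s.ofKernel (tensorKernel φ ψ) + s.ofKernel (tensorKernel φ ψ') :=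
  s.ofKernel_add fun p p' => by
    ext v
    simp only [tensorKernel, SqIntegrableSection.add_apply, InnerProductSpace.rankOne_apply,
      add_apply, inner_add_left, add_smul]

theorem ofKernel_tensorKernel_smul_left (c : ℂ) (φ ψ : SqIntegrableSection F S μ) :
    s.ofKernel (tensorKernel (c • φ) ψ) = c • s.ofKernel (tensorKernel φ ψ) :=
  s.ofKernel_smul c fun p p' => by
    ext v
    simp only [tensorKernel, SqIntegrableSection.smul_apply, InnerProductSpace.rankOne_apply,
      smul_apply, smul_comm c]

theorem ofKernel_tensorKernel_smul_right (c : ℂ) (φ ψ : SqIntegrableSection F S μ) :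
    s.ofKernel (tensorKernel φ (c • ψ)) = starRingEnd ℂ c • s.ofKernel (tensorKernel φ ψ) :=
  s.ofKernel_smul _ fun p p' => by
    ext v
    simp only [tensorKernel, SqIntegrableSection.smul_apply, InnerProductSpace.rankOne_apply,
      smul_apply, inner_smul_left, mul_smul]

theorem norm_ofKernel_tensorKernel (φ ψ : SqIntegrableSection F S μ) :
    ‖s.ofKernel (tensorKernel φ ψ)‖ = ‖φ‖ * ‖ψ‖ := by
  exact norm_eq_mul_norm_of_inner_self (s.inner_tensorKernel φ ψ φ ψ)

/-- The class of `|φ(p)⟩⟨ψ(p')|` depends only on the classes of `φ` and `ψ`. -/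
theorem ofKernel_tensorKernel_congr {φ φ' ψ ψ' : SqIntegrableSection F S μ}
    (h : (SeparationQuotient.mk φ : L2 F S μ) = SeparationQuotient.mk φ')
    (h' : (SeparationQuotient.mk ψ : L2 F S μ) = SeparationQuotient.mk ψ') :
    s.ofKernel (tensorKernel φ ψ) = s.ofKernel (tensorKernel φ' ψ') := by
  have h0 : ∀ {χ χ' : SqIntegrableSection F S μ},
      (SeparationQuotient.mk χ : L2 F S μ) = SeparationQuotient.mk χ' → ‖χ - χ'‖ = 0 := by
    intro χ χ' h
    rw [← SeparationQuotient.norm_mk, SeparationQuotient.mk_sub, h, sub_self, norm_zero]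
  have h1 : s.ofKernel (tensorKernel (φ - φ') ψ) = 0 := by
    rw [← norm_eq_zero, norm_ofKernel_tensorKernel, h0 h, zero_mul]
  have h2 : s.ofKernel (tensorKernel φ' (ψ - ψ')) = 0 := by
    rw [← norm_eq_zero, norm_ofKernel_tensorKernel, h0 h', mul_zero]
  calc s.ofKernel (tensorKernel φ ψ)
      = s.ofKernel (tensorKernel (φ - φ' + φ') (ψ - ψ' + ψ')) := by simp only [sub_add_cancel]
    _ = s.ofKernel (tensorKernel φ' ψ') := by
        have h3 : ψ - ψ' + ψ' = ψ := sub_add_cancel ψ ψ'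
        rw [ofKernel_tensorKernel_add_left, h3, h1, zero_add]
        conv_lhs => rw [← h3, ofKernel_tensorKernel_add_right, h2, zero_add]

end OrthonormalFrame

end KernelSpace

/-! ### Kernels of the Hilbert–Schmidt operators -/

section KernelModel

variable {M : Type*} [TopologicalSpace M] [MeasurableSpace M] [BorelSpace M]
  [SecondCountableTopology M]
  {F : Type*} [NormedAddCommGroup F] [NormedSpace ℂ F] [FiniteDimensional ℂ F]
  {S : M → Type*} [TopologicalSpace (TotalSpace F S)]
  [∀ x, NormedAddCommGroup (S x)] [∀ x, InnerProductSpace ℂ (S x)]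
  [FiberBundle F S] [VectorBundle ℂ F S] [IsHermitianBundle F S]
  {μ : Measure M}

namespace OrthonormalFrame

variable {ι : Type*} [Fintype ι] (s : OrthonormalFrame F S ι)

/-- The section `1_U s_i`. -/
def indicatorSection (i : ι) {U : Set M} (hU : MeasurableSet U) (hμ : μ U < ⊤) :
    SqIntegrableSection F S μ :=
  ⟨fun x => U.indicator (fun _ => (1 : ℂ)) x • s.basis x i,
    (s.measurable_basis i).fun_smul (measurable_const.indicator hU), by
    have h : ∀ x, ‖U.indicator (fun _ => (1 : ℂ)) x • s.basis x i‖ₑ ^ 2 =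
        U.indicator (fun _ => (1 : ℝ≥0∞)) x := fun x => by
      have h1 : ‖s.basis x i‖ₑ = 1 := by
        rw [← ofReal_norm, (s.basis x).norm_eq_one, ENNReal.ofReal_one]
      by_cases hx : x ∈ U
      · simp [hx, h1]
      · simp [hx]
    simp_rw [h]
    rwa [lintegral_indicator_const hU, one_mul]⟩

theorem indicatorSection_apply (i : ι) {U : Set M} (hU : MeasurableSet U) (hμ : μ U < ⊤) (x : M) :
    s.indicatorSection i hU hμ x = U.indicator (fun _ => (1 : ℂ)) x • s.basis x i := rfl

variable [SigmaFinite μ]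

/-- The kernels `|φ(p)⟩⟨ψ(p')|` are total: with `φ = 1_U s_i` and `ψ = 1_W s_j`, orthogonality to
them says that the integrals of the components over rectangles of finite measure vanish. -/
theorem eq_zero_of_inner_tensorKernel (k : Lp (EuclideanSpace ℂ (ι × ι)) 2 (μ.prod μ))
    (h : ∀ φ ψ : SqIntegrableSection F S μ, ⟪s.ofKernel (tensorKernel φ ψ), k⟫_ℂ = 0) :
    k = 0 := by
  have hrect : ∀ (q : ι × ι) (U W : Set M), MeasurableSet U → MeasurableSet W → μ U < ⊤ →
      μ W < ⊤ → ∫ z in U ×ˢ W, k z q ∂(μ.prod μ) = 0 := by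
    intro q U W hU hW hμU hμW
    rw [← h (s.indicatorSection q.1 hU hμU) (s.indicatorSection q.2 hW hμW),
      ← s.ofKernel_toKernel k, s.inner_ofKernel_tensorKernel, s.ofKernel_toKernel,
      ← integral_indicator (hU.prod hW)]
    refine integral_congr_ae (ae_of_all _ fun z => ?_)
    have h1 : ⟪s.basis z.1 q.1, (s.toKernel k).toFun z.1 z.2 (s.basis z.2 q.2)⟫_ℂ = k z q := by
      conv_rhs => rw [← homCoord_homOfCoord (s.basis z.1) (s.basis z.2) (k z)]
      rfl
    simp only [indicatorSection_apply, map_smul, inner_smul_left, inner_smul_right, h1]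
    by_cases hz1 : z.1 ∈ U <;> by_cases hz2 : z.2 ∈ W <;> simp [hz1, hz2]
  have hX : ∀ (n : ℕ) (q : ι × ι), ∀ᵐ z ∂(μ.prod μ),
      z ∈ spanningSets μ n ×ˢ spanningSets μ n → k z q = 0 := by
    intro n q
    have hm := measurableSet_spanningSets μ n
    have hlt := measure_spanningSets_lt_top μ n
    have : IsFiniteMeasure (μ.restrict (spanningSets μ n)) := ⟨by simpa using hlt⟩
    rw [← ae_restrict_iff' (hm.prod hm), ← Measure.prod_restrict]
    refine ae_eq_zero_of_setIntegral_prod (g := fun z => k z q) ?_ ?_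
    · have h1 : MemLp k 2
          ((μ.restrict (spanningSets μ n)).prod (μ.restrict (spanningSets μ n))) := by
        rw [Measure.prod_restrict]
        exact (Lp.memLp k).restrict _
      exact ((EuclideanSpace.proj (𝕜 := ℂ) q).comp_memLp' h1).integrable one_le_two
    · intro U W hU hW
      rw [Measure.prod_restrict, Measure.restrict_restrict (hU.prod hW), Set.prod_inter_prod]
      exact hrect q _ _ (hU.inter hm) (hW.inter hm)
        ((measure_mono Set.inter_subset_right).trans_lt hlt)
        ((measure_mono Set.inter_subset_right).trans_lt hlt)
  have hall := ae_all_iff.2 fun n => ae_all_iff.2 fun q => hX n q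
  rw [Lp.eq_zero_iff_ae_eq_zero]
  filter_upwards [hall] with z hz
  ext q
  refine hz (max (spanningSetsIndex μ z.1) (spanningSetsIndex μ z.2)) q ⟨?_, ?_⟩
  · exact monotone_spanningSets μ (le_max_left _ _) (mem_spanningSetsIndex μ z.1)
  · exact monotone_spanningSets μ (le_max_right _ _) (mem_spanningSetsIndex μ z.2)

/-- The square integrable kernels as a model of the Hilbert tensor product. The elementary tensor
of two classes is formed from representatives that depend linearly on the classes. -/
def tensorModel : TensorModel (Lp (EuclideanSpace ℂ (ι × ι)) 2 (μ.prod μ)) (L2 F S μ) where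
  tmul Φ Ψ := s.ofKernel (tensorKernel (SeparationQuotient.outCLM ℂ _ Φ)
    (SeparationQuotient.outCLM ℂ _ Ψ))
  add_left Φ Φ' Ψ := by rw [map_add, ofKernel_tensorKernel_add_left]
  smul_left c Φ Ψ := by rw [map_smul, ofKernel_tensorKernel_smul_left]
  add_right Φ Ψ Ψ' := by rw [map_add, ofKernel_tensorKernel_add_right]
  smul_right c Φ Ψ := by rw [map_smul, ofKernel_tensorKernel_smul_right]
  inner_tmul Φ Ψ Φ' Ψ' := by
    rw [inner_tensorKernel]
    conv_rhs =>
      rw [← SeparationQuotient.mk_outCLM ℂ Φ, ← SeparationQuotient.mk_outCLM ℂ Φ',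
        ← SeparationQuotient.mk_outCLM ℂ Ψ, ← SeparationQuotient.mk_outCLM ℂ Ψ',
        SeparationQuotient.inner_mk_mk, SeparationQuotient.inner_mk_mk]
  total k h := by
    refine s.eq_zero_of_inner_tensorKernel k fun φ ψ => ?_
    rw [← h (SeparationQuotient.mk φ) (SeparationQuotient.mk ψ)]
    congr 1
    exact s.ofKernel_tensorKernel_congr (SeparationQuotient.mk_outCLM _ _).symm
      (SeparationQuotient.mk_outCLM _ _).symm

theorem tensorModel_tmul_mk (φ ψ : SqIntegrableSection F S μ) :
    s.tensorModel.tmul (SeparationQuotient.mk φ) (SeparationQuotient.mk ψ) =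
      s.ofKernel (tensorKernel φ ψ) :=
  s.ofKernel_tensorKernel_congr (SeparationQuotient.mk_outCLM _ _)
    (SeparationQuotient.mk_outCLM _ _)

/-- The operator with the kernel `K` is the operator that the tensor model assigns to `K`. -/
theorem hasKernel_iff (A : L2 F S μ →L[ℂ] L2 F S μ) (K : L2Kernel F S μ) :
    HasKernel A K ↔ s.tensorModel.op (s.ofKernel K) = A := by
  rw [TensorModel.op_eq_iff, SeparationQuotient.surjective_mk.forall₂]
  refine forall₂_congr fun φ ψ => ?_
  rw [tensorModel_tmul_mk, inner_ofKernel_tensorKernel]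

theorem isHilbertSchmidt_op (k : Lp (EuclideanSpace ℂ (ι × ι)) 2 (μ.prod μ)) :
    IsHilbertSchmidt (s.tensorModel.op k) := by
  rw [isHilbertSchmidt_iff, TensorModel.hsNormSq_op]
  exact ENNReal.pow_lt_top enorm_lt_top

end OrthonormalFrame

end KernelModel

end TwistedHS

end

/-! ### Twists of Hilbert–Schmidt operators -/

theorem mainTheorem5 {n l : ℕ}
    -- a Riemannian manifold and its volume
    {M : Type*} [EMetricSpace M] [SecondCountableTopology M]
    [ChartedSpace (EuclideanSpace ℝ (Fin n)) M] [IsManifold (𝓡 n) ∞ M]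
    [RiemannianBundle (fun x : M => TangentSpace (𝓡 n) x)]
    [IsContMDiffRiemannianBundle (𝓡 n) ∞ (EuclideanSpace ℝ (Fin n))
      (fun x : M => TangentSpace (𝓡 n) x)]
    [IsRiemannianManifold (𝓡 n) M]
    [MeasurableSpace M] [BorelSpace M]
    (μ : Measure M) (hμ : TwistedHS.IsRiemannianVolume (n := n) μ)
    -- a Hermitian vector bundle over it
    {F : Type*} [NormedAddCommGroup F] [NormedSpace ℂ F] [FiniteDimensional ℂ F]
    {S : M → Type*} [TopologicalSpace (TotalSpace F S)]
    [∀ x, NormedAddCommGroup (S x)] [∀ x, InnerProductSpace ℂ (S x)]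
    [FiberBundle F S] [VectorBundle ℂ F S] [TwistedHS.IsHermitianBundle F S]
    -- a smooth isometric action, and unitary operators on the square integrable sections above it
    [AddAction (EuclideanSpace ℝ (Fin l)) M] [IsIsometricVAdd (EuclideanSpace ℝ (Fin l)) M]
    (hsmooth : ContMDiff (𝓘(ℝ, EuclideanSpace ℝ (Fin l)).prod (𝓡 n)) (𝓡 n) ∞
      (fun q : EuclideanSpace ℝ (Fin l) × M => q.1 +ᵥ q.2))
    (V : TwistedHS.UnitaryRep l (TwistedHS.L2 F S μ)) (hV : TwistedHS.CoversAction (n := n) V)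
    (Θ : Matrix (Fin l) (Fin l) ℝ) (hΘ : Θ.transpose = -Θ) :
    -- the twists exist, and preserve the Hilbert–Schmidt norm
    (∀ A : TwistedHS.L2 F S μ →L[ℂ] TwistedHS.L2 F S μ, TwistedHS.IsHilbertSchmidt A →
      TwistedHS.IsLeftTwist V Θ A (TwistedHS.leftTwist V Θ A) ∧
      TwistedHS.IsRightTwist V Θ A (TwistedHS.rightTwist V Θ A) ∧
      TwistedHS.IsHilbertSchmidt (TwistedHS.leftTwist V Θ A) ∧
      TwistedHS.IsHilbertSchmidt (TwistedHS.rightTwist V Θ A) ∧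
      TwistedHS.hsNorm (TwistedHS.leftTwist V Θ A) = TwistedHS.hsNorm A ∧
      TwistedHS.hsNorm (TwistedHS.rightTwist V Θ A) = TwistedHS.hsNorm A) ∧
    -- the Hilbert–Schmidt operators are the operators with a square integrable kernel
    (∀ A : TwistedHS.L2 F S μ →L[ℂ] TwistedHS.L2 F S μ,
      TwistedHS.IsHilbertSchmidt A ↔ ∃ K : TwistedHS.L2Kernel F S μ, TwistedHS.HasKernel A K) ∧
    (∀ K : TwistedHS.L2Kernel F S μ, ∃ A : TwistedHS.L2 F S μ →L[ℂ] TwistedHS.L2 F S μ,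
      TwistedHS.HasKernel A K ∧ TwistedHS.hsNorm A = K.l2Norm) ∧
    -- the left twist is an isometry on the kernels
    ∃ T : TwistedHS.L2Kernel F S μ → TwistedHS.L2Kernel F S μ,
      (∀ (A : TwistedHS.L2 F S μ →L[ℂ] TwistedHS.L2 F S μ) (K : TwistedHS.L2Kernel F S μ),
        TwistedHS.HasKernel A K → TwistedHS.HasKernel (TwistedHS.leftTwist V Θ A) (T K)) ∧
      ∀ K K' : TwistedHS.L2Kernel F S μ, (T K).l2Dist (T K') = K.l2Dist K' := by
  have := hμ.sigmaFinite
  obtain ⟨s, hs⟩ := TwistedHS.exists_measurable_orthonormal_frame F S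
  let s' : TwistedHS.OrthonormalFrame F S (Fin (Module.finrank ℂ F)) := ⟨s, hs⟩
  let t := s'.tensorModel (μ := μ)
  have hex : ∀ A, TwistedHS.IsHilbertSchmidt A → ∃ k, t.op k = A := fun A hA =>
    t.exists_op_eq A (TwistedHS.isHilbertSchmidt_iff.1 hA)
  -- isometries of the space of kernels, which are the twists if kernels are read as operators
  obtain ⟨TL, hTL⟩ := t.hsModel.exists_leftTwist V Θ
  obtain ⟨TR, hTR⟩ := t.hsModel.exists_rightTwist V Θ
  simp only [TwistedHS.TensorModel.hsModel_toOp] at hTL hTR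
  refine ⟨fun A hA => ?_, fun A => ⟨fun hA => ?_, ?_⟩, fun K => ?_, ?_⟩
  · obtain ⟨k, rfl⟩ := hex A hA
    rw [TwistedHS.isLeftTwist_leftTwist (hTL k), TwistedHS.isRightTwist_rightTwist (hTR k)]
    refine ⟨hTL k, hTR k, s'.isHilbertSchmidt_op _, s'.isHilbertSchmidt_op _, ?_, ?_⟩
    · rw [TwistedHS.hsNorm, TwistedHS.hsNorm, t.hsNormSq_op, t.hsNormSq_op, TL.enorm_map]
    · rw [TwistedHS.hsNorm, TwistedHS.hsNorm, t.hsNormSq_op, t.hsNormSq_op, TR.enorm_map]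
  · obtain ⟨k, rfl⟩ := hex A hA
    exact ⟨s'.toKernel k, (s'.hasKernel_iff _ _).2 (by rw [s'.ofKernel_toKernel])⟩
  · rintro ⟨K, hK⟩
    rw [← (s'.hasKernel_iff A K).1 hK]
    exact s'.isHilbertSchmidt_op _
  · refine ⟨t.op (s'.ofKernel K), (s'.hasKernel_iff _ _).2 rfl, ?_⟩
    rw [TwistedHS.hsNorm, t.hsNormSq_op, s'.enorm_ofKernel_sq, TwistedHS.L2Kernel.l2Norm]
  · refine ⟨fun K => s'.toKernel (TL (s'.ofKernel K)), fun A K hK => ?_, fun K K' => ?_⟩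
    · rw [← (s'.hasKernel_iff A K).1 hK, TwistedHS.isLeftTwist_leftTwist (hTL _),
        s'.hasKernel_iff, s'.ofKernel_toKernel]
    · rw [TwistedHS.L2Kernel.l2Dist, TwistedHS.L2Kernel.l2Dist, ← s'.enorm_ofKernel_sub_sq,
        ← s'.enorm_ofKernel_sub_sq, s'.ofKernel_toKernel, s'.ofKernel_toKernel, ← map_sub,
        TL.enorm_map]
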